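/- **Setting.** Fix a finite set $\mathcal P$ of participants and a finite set $\mathcal V$ of messages. An *interaction* $p\to q:m$ consists of a sender $p$ and a receiver $q\neq p$ in $\mathcal P$ and a message $m\in\mathcal V$; let $\Gamma$ be the set of interactions. Let $\Sigma$ be the set of *events*: for every interaction $p\to q:m$ the send event $p!q:m$ and the receive event $p?q:m$ ($q$ receives $m$ from $p$). We identify $p\to q:m$ with the two-letter word $(p!q:m)(p?q:m)$, so words over $\Gamma$ are read as words over $\Sigma$. Write $X^\infty=X^*\cup X^\omega$. **State machines.** A state machine $A$ with states $Q$, initial state $q_0$ and final states $F\subseteq Q$ has transitions labelled by letters or $\varepsilon$. A run is a finite or infinite sequence of consecutive transitions from $q_0$; it is maximal if it is infinite or ends in $F$. The *core language* $L(A)$ is the set of traces (concatenations of the labels) of maximal runs. $A$ is *dense* if a state with an outgoing $\varepsilon$-transition has no other outgoing transition; a dense $A$ is *deterministic* if $q\xrightarrow{a}q'$ and $q\xrightarrow{a}q''$ imply $q'=q''$; $A$ is *sink-final* if a state is final iff it has no outgoing transitions. **FIFO words.** For a finite word $u$ and $p\ne q$, let $s_{pq}(u)$, $r_{pq}(u)$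 be the sequences of messages sent, resp. received, from $p$ to $q$ in $u$. A word $w\in\Sigma^\infty$ is *channel-compliant* if $r_{pq}(u)$ is a prefix of $s_{pq}(u)$ for all finite prefixes $u$ of $w$ and all $p,q$. A *FIFO word* is a channel-compliant word that is infinite or satisfies $s_{pq}(w)=r_{pq}(w)$ for all $p,q$. A channel-compliant word is *$B$-bounded* (*sum-$B$-bounded*) if $|s_{pq}(u)|-|r_{pq}(u)|\le B$ for all $p,q$ (resp. $\sum_{p\ne q}(|s_{pq}(u)|-|r_{pq}(u)|)\le B$) for all finite prefixes $u$. In $w=w_1w_2\dots$ the send event $w_i=p!q:m$ is *matched* if there is $j>i$ with $w_j=p?q:m$ and $s_{pq}(w_1\dots w_i)=r_{pq}(w_1\dots w_j)$. A language $L$ satisfies *feasible eventual reception* if, for every finite prefix $u$ of a word of $L$ and every send event of $u$ that is unmatched in $u$, some word of $L$ extends $u$ and matches that event. **Semantics.** Let $\sim$ be the smallest equivalence relation on $\Sigma^*$ such that $w\,x\,y\,u\sim w\,y\,x\,u$ if (1) $x,y$ are sends with different senders; (2) $x,y$ are receives with different receivers; (3) $x=p!q:m$, $y=p'?q':m'$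 with $p\ne q'$ and ($p\neq p'$ or $q\ne q'$); or (4) $x=p!q:m$, $y=p?q:m'$ and $|s_{pq}(w)|>|r_{pq}(w)|$. Write $u\preceq v$ if $uw\sim v$ for some $w$; for infinite words $f\preceq^\omega g$ if every finite prefix of $f$ is $\preceq$ some finite prefix of $g$. The closure $\mathcal C(L)$ consists of the finite words $\sim$-equivalent to a finite word of $L$ and the infinite words $f$ with $f\preceq^\omega g$ for some infinite $g\in L$. A *PSM* is a dense state machine $M$ over $\Sigma$ with finitely many states such that, for some $B$, all words of $L(M)$ are $B$-bounded FIFO words, and such that $L(M)$ satisfies feasible eventual reception; its semantics is $\mathcal C(L(M))$. It is a *1-PSM* (more precisely, a $\Sigma1$-PSM) if moreover all words of $L(M)$ are sum-$1$-bounded. A PSM satisfies *mixed choice* if it is deterministic; it is *sender-driven* if it is deterministic and there is $c:Q\to\mathcal P$ such that every send transition from a state $q$ has sender $c(q)$; it is *directed* if, in addition, there is $d:Q\to\mathcal P$ such that every send transition from $q$ has receiver $d(q)$. **Global types** are the terms $G::=0\mid\sum_{i\in I}p_i\to q_i:m_i\,.\,G_i\mid\mu t.G\mid t$ ($I$ finite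 and nonempty, repeated branches allowed) in which different binders bind different variables, every variable is bound, and there is an interaction between a binder $\mu t$ and every use of $t$. The state machine over $\Gamma$ of $G$ has as states the occurrences of subterms of $G$, initial state $G$, final states the occurrences of $0$, a transition labelled $p_i\to q_i:m_i$ from each sum to each $G_i$, and $\varepsilon$-transitions from $\mu t.G'$ to $G'$ and from each $t$ to its binder $\mu t.G'$. The core language of $G$ is that of its state machine, read over $\Sigma$; the semantics of $G$ is its closure under $\mathcal C$. $G$ satisfies *mixed choice* if in every sum subterm the branches $i\neq j$ have different interactions; otherwise $G$ is *non-deterministic*. $G$ is *sender-driven* if for all branches $i\ne j$ of a sum subterm $p_i=p_j$ and ($q_i\neq q_j$ or $m_i\ne m_j$); it is *directed* if $p_i=p_j$, $q_i=q_j$ and $m_i\neq m_j$. **Theorem.** For every sink-final 1-PSM $M$ there is a global type $G$ with the same core language as $M$, and hence with the same semantics, such that moreover: - if some reachable state of $M$ has two different outgoing transitions with the same label, then $G$ is non-deterministic; - if $M$ satisfies mixed choice, then so does $G$; - if $M$ is sender-driven, then so is $G$; - if $M$ is directed, then so is $G$. -/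

import Mathlib

namespace PSM

universe u v

/-! ### Words and state machines -/

/-- A finite or infinite word over `α`, i.e. an element of `α^∞ = α^* ∪ α^ω`. -/
inductive Word (α : Type u) : Type u
  | fin : List α → Word α
  | inf : (ℕ → α) → Word α

namespace Word

variable {α : Type u}

/-- The prefix of length `n` (the whole word if it is shorter). -/
def take : Word α → ℕ → List α
  | fin l, n => l.take n
  | inf f, n => (List.range n).map f

/-- The letter at position `i` (counted from `0`), if there is one. -/
def letter : Word α → ℕ → Option α
  | fin l, i => l[i]?
  | inf f, i => some (f i)

/-- The finite word `u` is a prefix of the word `w`. -/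
def IsPrefix (u : List α) (w : Word α) : Prop := ∃ n, w.take n = u

/-- The word `u` is a prefix of the word `w`. -/
def LE : Word α → Word α → Prop
  | fin u, w => IsPrefix u w
  | inf f, w => w = inf f

end Word

/-- The word `w` is the concatenation `a₀ a₁ a₂ …` of the infinitely many labels `f`, where
`none` stands for the empty word. The result may be finite. -/
def IsConcat {α : Type u} (f : ℕ → Option α) : Word α → Prop
  | .fin l => ∃ N, ∀ n, N ≤ n → ((List.range n).map f).reduceOption = l
  | .inf g => ∀ k, ∃ n, ((List.range n).map f).reduceOption = (List.range k).map g

/-- State machines over the alphabet `α`; the label `none` is the empty word `ε`. -/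
structure StateMachine (α : Type u) where
  State : Type v
  step : State → Option α → State → Prop
  init : State
  final : Set State

namespace StateMachine

variable {α : Type u} (A : StateMachine.{u, v} α)

/-- Finite sequences of consecutive transitions, with their list of labels. -/
inductive Path : A.State → List (Option α) → A.State → Prop
  | nil (q : A.State) : Path q [] q
  | cons {q q' q'' : A.State} {x : Option α} {l : List (Option α)} :
      A.step q x q' → Path q' l q'' → Path q (x :: l) q''

/-- There is a run from the initial state to `q`. -/
def Reachable (q : A.State) : Prop := ∃ l, A.Path A.init l q

/-- `w` is the trace of a finite run that ends in a final state. -/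
def FiniteTrace (w : Word α) : Prop :=
  ∃ q ∈ A.final, ∃ l, A.Path A.init l q ∧ w = .fin l.reduceOption

/-- `w` is the trace of an infinite run. -/
def InfiniteTrace (w : Word α) : Prop :=
  ∃ (q : ℕ → A.State) (x : ℕ → Option α),
    q 0 = A.init ∧ (∀ i, A.step (q i) (x i) (q (i + 1))) ∧ IsConcat x w

/-- The core language: the traces of all maximal runs. -/
def language : Set (Word α) := {w | A.FiniteTrace w ∨ A.InfiniteTrace w}

/-- A state with an `ε`-transition has only one outgoing transition. -/
def Dense : Prop :=
  ∀ q q', A.step q none q' → ∀ x q'', A.step q x q'' → x = none ∧ q'' = q'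

/-- Determinism of dense state machines. -/
def Deterministic : Prop :=
  ∀ q x q' q'', A.step q x q' → A.step q x q'' → q' = q''

def IsSink (q : A.State) : Prop := ∀ x q', ¬ A.step q x q'

def SinkFinal : Prop := ∀ q, q ∈ A.final ↔ A.IsSink q

/-- Some reachable state has two different outgoing transitions with the same label. -/
def ReachablyNonDeterministic : Prop :=
  ∃ q, A.Reachable q ∧ ∃ x q' q'', A.step q x q' ∧ A.step q x q'' ∧ q' ≠ q''

end StateMachine

/-! ### Events and FIFO languages -/

/-- An interaction `src → dst : msg`. Channels connect distinct participants. -/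
structure Interaction (P : Type u) (V : Type v) where
  src : P
  dst : P
  msg : V
  ne : src ≠ dst

/-- Asynchronous events: `snd ⟨p, q, m, _⟩` is the event that `p` sends `m` to `q`, and
`rcv ⟨p, q, m, _⟩` is the event that `q` receives `m` from `p`. -/
inductive Event (P : Type u) (V : Type v)
  | snd : Interaction P V → Event P V
  | rcv : Interaction P V → Event P V

section Fifo

variable {P : Type u} {V : Type v} [DecidableEq P]

/-- The message that the event sends from `p` to `q`, if it does so. -/
def sentMsg (p q : P) : Event P V → Option V
  | .snd x => if x.src = p ∧ x.dst = q then some x.msg else none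
  | .rcv _ => none

/-- The message from `p` that `q` receives in the event, if it does so. -/
def receivedMsg (p q : P) : Event P V → Option V
  | .snd _ => none
  | .rcv x => if x.src = p ∧ x.dst = q then some x.msg else none

/-- The sequence of messages that `p` sends to `q` in `w`. -/
def sent (p q : P) (w : List (Event P V)) : List V := w.filterMap (sentMsg p q)

/-- The sequence of messages that `q` receives from `p` in `w`. -/
def received (p q : P) (w : List (Event P V)) : List V := w.filterMap (receivedMsg p q)

/-- The number of messages from `p` to `q` that are pending after `w`. -/
def pending (p q : P) (w : List (Event P V)) : ℤ :=
  ((sent p q w).length : ℤ) - ((received p q w).length : ℤ)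

def ChannelCompliant (w : Word (Event P V)) : Prop :=
  ∀ u, Word.IsPrefix u w → ∀ p q, received p q u <+: sent p q u

/-- The set of FIFO words: in finite words, all messages have to be received. -/
def FIFO : Set (Word (Event P V)) :=
  {w | ChannelCompliant w ∧ ∀ u, w = .fin u → ∀ p q, sent p q u = received p q u}

def Bounded (B : ℕ) (w : Word (Event P V)) : Prop :=
  ChannelCompliant w ∧ ∀ u, Word.IsPrefix u w → ∀ p q, pending p q u ≤ B

/-- The total number of pending messages is at most `B` at all times. -/
def SumBounded [Fintype P] (B : ℕ) (w : Word (Event P V)) : Prop :=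
  ChannelCompliant w ∧ ∀ u, Word.IsPrefix u w →
    ∑ c : P × P with c.1 ≠ c.2, pending c.1 c.2 u ≤ B

/-- The set of `B`-bounded FIFO words. -/
def FIFOBounded (B : ℕ) : Set (Word (Event P V)) := {w | w ∈ FIFO ∧ Bounded B w}

/-- The letter of `w` at position `i` is a send event, and it is matched by a receive event. -/
def IsMatched (w : Word (Event P V)) (i : ℕ) : Prop :=
  ∃ x j, w.letter i = some (.snd x) ∧ w.letter j = some (.rcv x) ∧ i < j ∧
    sent x.src x.dst (w.take (i + 1)) = received x.src x.dst (w.take (j + 1))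

def FeasibleEventualReception (L : Set (Word (Event P V))) : Prop :=
  ∀ u : List (Event P V), (∃ w ∈ L, Word.IsPrefix u w) →
    ∀ i x, u[i]? = some (.snd x) → ¬ IsMatched (.fin u) i →
      ∃ w ∈ L, Word.LE (.fin u) w ∧ IsMatched w i

/-! ### Indistinguishability and closure -/

/-- One reordering step of two adjacent independent events. -/
inductive Swap : List (Event P V) → List (Event P V) → Prop
  | sndSnd (w u : List (Event P V)) (x y : Interaction P V) : x.src ≠ y.src →
      Swap (w ++ [.snd x, .snd y] ++ u) (w ++ [.snd y, .snd x] ++ u)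
  | rcvRcv (w u : List (Event P V)) (x y : Interaction P V) : x.dst ≠ y.dst →
      Swap (w ++ [.rcv x, .rcv y] ++ u) (w ++ [.rcv y, .rcv x] ++ u)
  | sndRcv (w u : List (Event P V)) (x y : Interaction P V) :
      x.src ≠ y.dst → (x.src ≠ y.src ∨ x.dst ≠ y.dst) →
      Swap (w ++ [.snd x, .rcv y] ++ u) (w ++ [.rcv y, .snd x] ++ u)
  | sndRcvSame (w u : List (Event P V)) (x y : Interaction P V) :
      x.src = y.src → x.dst = y.dst →
      (received x.src x.dst w).length < (sent x.src x.dst w).length →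
      Swap (w ++ [.snd x, .rcv y] ++ u) (w ++ [.rcv y, .snd x] ++ u)

/-- The indistinguishability relation on finite words: the smallest equivalence relation that
contains all reordering steps. -/
def Indist : List (Event P V) → List (Event P V) → Prop := Relation.EqvGen Swap

/-- `u` can be completed to a word that is indistinguishable from `v`. -/
def IndistPrefix (u v : List (Event P V)) : Prop := ∃ w, Indist (u ++ w) v

/-- The preorder on infinite words that is induced by `IndistPrefix`. -/
def IndistPrefixInf (f g : ℕ → Event P V) : Prop :=
  ∀ n, ∃ m, IndistPrefix ((Word.inf f).take n) ((Word.inf g).take m)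

/-- The closure of a language under indistinguishability. -/
def closure (L : Set (Word (Event P V))) : Set (Word (Event P V)) :=
  {w' | (∃ u' u, w' = .fin u' ∧ Word.fin u ∈ L ∧ Indist u' u) ∨
    (∃ f' f, w' = .inf f' ∧ Word.inf f ∈ L ∧ IndistPrefixInf f' f)}

/-! ### Protocol state machines -/

/-- `B`-PSMs. -/
structure IsBPSM (B : ℕ) (M : StateMachine (Event P V)) : Prop where
  finite : Finite M.State
  dense : M.Dense
  bounded : M.language ⊆ FIFOBounded B
  reception : FeasibleEventualReception M.language

def IsPSM (M : StateMachine (Event P V)) : Prop := ∃ B, IsBPSM B M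

/-- PSMs with a sum-`1`-bounded core language. -/
def IsSumOnePSM [Fintype P] (M : StateMachine (Event P V)) : Prop :=
  IsPSM M ∧ ∀ w ∈ M.language, SumBounded 1 w

/-- The semantics of a PSM: the closure of its core language. -/
def semantics (M : StateMachine (Event P V)) : Set (Word (Event P V)) := closure M.language

end Fifo

section Choice

variable {P : Type u} {V : Type v} (M : StateMachine (Event P V))

/-- Mixed choice. -/
def MixedChoice : Prop := M.Deterministic

/-- Sender-driven choice: all sends of a state are by the same participant, and distinct
transitions have distinct labels. -/
def SenderDriven : Prop :=
  M.Deterministic ∧ ∃ c : M.State → P, ∀ q x q', M.step q (some (.snd x)) q' → x.src = c q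

/-- Directed choice: in addition, all sends of a state go to the same receiver. -/
def Directed : Prop :=
  M.Deterministic ∧ ∃ c d : M.State → P, ∀ q x q', M.step q (some (.snd x)) q' →
    x.src = c q ∧ x.dst = d q

end Choice

/-! ### Global types -/

/-- Terms for global types: `0`, `∑ i ∈ I, (pᵢ → qᵢ : mᵢ) . Gᵢ` with a finite nonempty index set
(here `Fin (n + 1)`), `μ t . G`, and recursion variables `t`. -/
inductive GlobalType (P : Type u) (V : Type v)
  | zero : GlobalType P V
  | sum (n : ℕ) (lbl : Fin (n + 1) → Interaction P V) (cont : Fin (n + 1) → GlobalType P V) :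
      GlobalType P V
  | mu (t : ℕ) (body : GlobalType P V) : GlobalType P V
  | var (t : ℕ) : GlobalType P V

namespace GlobalType

variable {P : Type u} {V : Type v}

/-- The syntactic subterm at an address. Addresses index the occurrences of subterms: `[]` is the
address of the whole term, the `i`-th branch of a sum at `a` has address `a ++ [i]`, and the body
of a recursion at `a` has address `a ++ [0]`. -/
def sub : GlobalType P V → List ℕ → Option (GlobalType P V)
  | G, [] => some G
  | .sum n _ cont, i :: a => if h : i < n + 1 then (cont ⟨i, h⟩).sub a else none
  | .mu _ body, 0 :: a => body.sub a
  | _, _ => none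

/-- The standing assumptions on global types. -/
structure WellFormed (G : GlobalType P V) : Prop where
  /-- Different binders bind different variables. -/
  distinct : ∀ a b t g h, G.sub a = some (.mu t g) → G.sub b = some (.mu t h) → a = b
  /-- Every variable is bound, with at least one interaction between the binder and the use. -/
  bound_guarded : ∀ a t, G.sub a = some (.var t) →
    ∃ b g, b <+: a ∧ G.sub b = some (.mu t g) ∧
      ∃ c n lbl cont, b <+: c ∧ c <+: a ∧ G.sub c = some (.sum n lbl cont)

/-- The transitions between the subterms of `G`. -/
inductive Step (G : GlobalType P V) : List ℕ → Option (Interaction P V) → List ℕ → Prop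
  | comm {a : List ℕ} {n : ℕ} {lbl : Fin (n + 1) → Interaction P V}
      {cont : Fin (n + 1) → GlobalType P V} :
      G.sub a = some (.sum n lbl cont) → ∀ i : Fin (n + 1),
        Step G a (some (lbl i)) (a ++ [(i : ℕ)])
  | unfold {a : List ℕ} {t : ℕ} {g : GlobalType P V} :
      G.sub a = some (.mu t g) → Step G a none (a ++ [0])
  | recur {a b : List ℕ} {t : ℕ} {g : GlobalType P V} :
      G.sub a = some (.var t) → b <+: a → G.sub b = some (.mu t g) → Step G a none b

/-- The state machine of a global type; its states are the indexed syntactic subterms. -/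
def machine (G : GlobalType P V) : StateMachine.{max u v, 0} (Interaction P V) where
  State := {a : List ℕ // (G.sub a).isSome}
  step a x b := Step G a.1 x b.1
  init := ⟨[], by cases G <;> rfl⟩
  final := {a | G.sub a.1 = some .zero}

/-- Read `p → q : m` as the send event followed by the corresponding receive event. -/
def expand : Word (Interaction P V) → Word (Event P V)
  | .fin l => .fin (l.flatMap fun x => [.snd x, .rcv x])
  | .inf f => .inf fun n => if n % 2 = 0 then .snd (f (n / 2)) else .rcv (f (n / 2))

/-- The core language of a global type, as a language of asynchronous events. -/
def coreLanguage (G : GlobalType P V) : Set (Word (Event P V)) := expand '' G.machine.language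

/-- The semantics of a global type: the closure of its core language. -/
def semantics [DecidableEq P] (G : GlobalType P V) : Set (Word (Event P V)) :=
  closure G.coreLanguage

/-- The branches of every choice are pairwise distinct. -/
def MixedChoice (G : GlobalType P V) : Prop :=
  ∀ a n lbl cont, G.sub a = some (.sum n lbl cont) → ∀ i j : Fin (n + 1), i ≠ j →
    (lbl i).src ≠ (lbl j).src ∨ (lbl i).dst ≠ (lbl j).dst ∨ (lbl i).msg ≠ (lbl j).msg

def NonDeterministic (G : GlobalType P V) : Prop := ¬ G.MixedChoice

def SenderDriven (G : GlobalType P V) : Prop :=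
  ∀ a n lbl cont, G.sub a = some (.sum n lbl cont) → ∀ i j : Fin (n + 1), i ≠ j →
    (lbl i).src = (lbl j).src ∧
      ((lbl i).dst ≠ (lbl j).dst ∨ (lbl i).msg ≠ (lbl j).msg)

def Directed (G : GlobalType P V) : Prop :=
  ∀ a n lbl cont, G.sub a = some (.sum n lbl cont) → ∀ i j : Fin (n + 1), i ≠ j →
    (lbl i).src = (lbl j).src ∧ (lbl i).dst = (lbl j).dst ∧ (lbl i).msg ≠ (lbl j).msg

end GlobalType

end PSM

/-! In a core word, whenever all channels are empty the next event must be a send, because channel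
compliance forbids a receive. After that send one message is pending: the sum bound 1 forbids a
second send, channel compliance admits only the matching receive, and the word cannot stop because
finite core words are FIFO. So the core words are exactly the expansions of words over interactions.
They are spelled by the maximal paths of the relation `PairStep`, which does a send and then its
receive, with ε-transitions absorbed (`expand_image_relLanguage`). These facts pass from words to
states because in a sink-final dense machine every finite path extends to a maximal run
(`WeakPath.exists_mem_language`).

It remains to write the finite transition system `PairStep` as a global type. It is unfolded into a
tree: a state met for the first time on a branch becomes a `μ` over the sum of its outgoing steps,
and a state met again becomes the variable of its earlier occurrence. Each level binds a new state,
so depth `card + 1` suffices. The address tree is bisimilar to the system (`language_build`), and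
equality of semantics follows from equality of core languages.

Each sum of the tree lists the pair steps of one state. Determinism makes their labels distinct.
Density makes all sends readable from a state leave one and the same state of the machine, so
sender-driven and directed choice carry over. Each pair step is listed together with its
intermediate state, so reachable non-determinism survives as a repeated branch. -/

namespace PSM

universe u v

/-! ### Absorbing ε-transitions into letter steps -/

namespace StateMachine

variable {α : Type u} (A : StateMachine.{u, v} α)

/-- `k` many `ε`-transitions, followed by a transition labelled `x`. -/
inductive WeakStep : ℕ → A.State → α → A.State → Prop
  | base {q q' : A.State} {x : α} : A.step q (some x) q' → WeakStep 0 q x q'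
  | eps {k : ℕ} {q q' q'' : A.State} {x : α} :
      A.step q none q' → WeakStep k q' x q'' → WeakStep (k + 1) q x q''

def BigStep (q : A.State) (x : α) (q' : A.State) : Prop := ∃ k, A.WeakStep k q x q'

inductive WeakPath : A.State → List α → A.State → Prop
  | nil (q : A.State) : WeakPath q [] q
  | cons {q q' q'' : A.State} {x : α} {l : List α} :
      A.BigStep q x q' → WeakPath q' l q'' → WeakPath q (x :: l) q''

/-- No further letter can be read from `q`. -/
def Terminal (q : A.State) : Prop := ∀ x q', ¬ A.BigStep q x q'

def Eps : A.State → A.State → Prop := Relation.ReflTransGen fun q q' => A.step q none q'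

variable {A}

theorem Path.append {q r s : A.State} {l m : List (Option α)} (h : A.Path q l r)
    (h' : A.Path r m s) : A.Path q (l ++ m) s := by
  induction h with
  | nil => exact h'
  | cons hs _ ih => exact .cons hs (ih h')

theorem WeakPath.append {q r s : A.State} {l m : List α} (h : A.WeakPath q l r)
    (h' : A.WeakPath r m s) : A.WeakPath q (l ++ m) s := by
  induction h with
  | nil => exact h'
  | cons hs _ ih => exact .cons hs (ih h')

theorem BigStep.weakPath {q r : A.State} {x : α} (h : A.BigStep q x r) : A.WeakPath q [x] r :=
  .cons h (.nil _)

theorem BigStep.eps {q q' r : A.State} {x : α} (h : A.step q none q') (h' : A.BigStep q' x r) :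
    A.BigStep q x r := by
  obtain ⟨k, hk⟩ := h'
  exact ⟨k + 1, .eps h hk⟩

theorem Eps.bigStep {q q' r : A.State} {x : α} (h : A.Eps q q') (h' : A.BigStep q' x r) :
    A.BigStep q x r := by
  induction h using Relation.ReflTransGen.head_induction_on with
  | refl => exact h'
  | head hs _ ih => exact ih.eps hs

theorem BigStep.exists_eps {q r : A.State} {x : α} (h : A.BigStep q x r) :
    ∃ s, A.Eps q s ∧ A.step s (some x) r := by
  obtain ⟨k, hk⟩ := h
  induction hk with
  | base h => exact ⟨_, .refl, h⟩
  | eps h _ ih =>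
    obtain ⟨s, hs, h'⟩ := ih
    exact ⟨s, .head h hs, h'⟩

/-- Each ε is charged to the next letter; those after the last letter remain as the `Eps` tail. -/
theorem Path.weakPath {q r : A.State} {l : List (Option α)} (h : A.Path q l r) :
    ∃ s, A.WeakPath q l.reduceOption s ∧ A.Eps s r := by
  induction h with
  | nil q => exact ⟨q, .nil q, .refl⟩
  | @cons q q' q'' x l hs _ ih =>
    obtain ⟨s, hw, he⟩ := ih
    cases x with
    | some x => exact ⟨s, by simpa using .cons ⟨0, .base hs⟩ hw, he⟩
    | none =>
      rw [List.reduceOption_cons_of_none]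
      revert hw
      generalize l.reduceOption = m
      intro hw
      cases hw with
      | nil => exact ⟨q, .nil q, .head hs he⟩
      | cons hb hw => exact ⟨s, .cons (hb.eps hs) hw, he⟩

theorem Eps.path {q r : A.State} (h : A.Eps q r) :
    ∃ l, A.Path q l r ∧ l.reduceOption = [] := by
  induction h using Relation.ReflTransGen.head_induction_on with
  | refl => exact ⟨[], .nil _, rfl⟩
  | head hs _ ih =>
    obtain ⟨l, hl, he⟩ := ih
    exact ⟨none :: l, .cons hs hl, by simpa using he⟩

theorem WeakPath.path {q r : A.State} {l : List α} (h : A.WeakPath q l r) :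
    ∃ m, A.Path q m r ∧ m.reduceOption = l := by
  induction h with
  | nil q => exact ⟨[], .nil _, rfl⟩
  | @cons q q' q'' x l hb _ ih =>
    obtain ⟨s, he, hs⟩ := hb.exists_eps
    obtain ⟨m₁, h₁, e₁⟩ := he.path
    obtain ⟨m₂, h₂, e₂⟩ := ih
    exact ⟨m₁ ++ some x :: m₂, h₁.append (.cons hs h₂), by
      simp [List.reduceOption_append, e₁, e₂]⟩

/-- By density the ε-transition is the only one leaving `q`, so every big step starts with it. -/
theorem BigStep.of_eps (hd : A.Dense) {q q' r : A.State} {x : α} (h : A.step q none q')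
    (hb : A.BigStep q x r) : A.BigStep q' x r := by
  obtain ⟨k, hk⟩ := hb
  cases hk with
  | base h' => exact absurd (hd _ _ h _ _ h').1 (by simp)
  | eps h' hk =>
    obtain rfl := (hd _ _ h _ _ h').2
    exact ⟨_, hk⟩

theorem Terminal.of_eps (hd : A.Dense) {q r : A.State} (h : A.Eps q r) (hr : A.Terminal r) :
    A.Terminal q := by
  induction h using Relation.ReflTransGen.head_induction_on with
  | refl => exact hr
  | head hs _ ih => exact fun x s hb => ih x s (hb.of_eps hd hs)

theorem terminal_of_isSink {q : A.State} (h : A.IsSink q) : A.Terminal q := by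
  rintro x q' ⟨k, hk⟩
  cases hk with
  | base h' => exact h _ _ h'
  | eps h' => exact h _ _ h'

theorem terminal_of_diverges (hd : A.Dense) {q : ℕ → A.State}
    (h : ∀ i, A.step (q i) none (q (i + 1))) : A.Terminal (q 0) := by
  rintro x r ⟨k, hk⟩
  induction k generalizing q with
  | zero =>
    cases hk with
    | base h' => exact absurd (hd _ _ (h 0) _ _ h').1 (by simp)
  | succ k ih =>
    cases hk with
    | eps h' hk =>
      obtain rfl := (hd _ _ (h 0) _ _ h').2
      exact ih (q := fun i => q (i + 1)) (fun i => h (i + 1)) hk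

theorem path_of_run {q : ℕ → A.State} {x : ℕ → Option α}
    (h : ∀ i, A.step (q i) (x i) (q (i + 1))) (n : ℕ) :
    A.Path (q 0) ((List.range n).map x) (q n) := by
  induction n with
  | zero => exact .nil _
  | succ n ih =>
    rw [List.range_succ, List.map_append]
    exact ih.append (.cons (h n) (.nil _))

end StateMachine

/-! ### Concatenations of infinite label sequences -/

section Concat

variable {α : Type u}

theorem map_range_succ {β : Type*} (f : ℕ → β) (n : ℕ) :
    (List.range (n + 1)).map f = f 0 :: (List.range n).map fun i => f (i + 1) := by
  simp [List.range_succ_eq_map, Function.comp_def]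

theorem IsConcat.fin_cons {x : ℕ → Option α} {l : List α}
    (h : IsConcat (fun i => x (i + 1)) (.fin l)) : IsConcat x (.fin ([x 0].reduceOption ++ l)) := by
  obtain ⟨N, hN⟩ := h
  refine ⟨N + 1, fun n hn => ?_⟩
  obtain ⟨n, rfl⟩ : ∃ m, n = m + 1 := ⟨n - 1, by omega⟩
  rw [map_range_succ, ← hN n (by omega), ← List.reduceOption_append]
  rfl

theorem IsConcat.inf_none {x : ℕ → Option α} {g : ℕ → α} (h : IsConcat x (.inf g))
    (h0 : x 0 = none) : IsConcat (fun i => x (i + 1)) (.inf g) := by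
  intro k
  obtain ⟨n, hn⟩ := h k
  cases n with
  | zero => exact ⟨0, hn⟩
  | succ n =>
    rw [map_range_succ, h0, List.reduceOption_cons_of_none] at hn
    exact ⟨n, hn⟩

theorem IsConcat.inf_some {x : ℕ → Option α} {g : ℕ → α} {a : α} (h : IsConcat x (.inf g))
    (h0 : x 0 = some a) : a = g 0 ∧ IsConcat (fun i => x (i + 1)) (.inf fun i => g (i + 1)) := by
  have key : ∀ k, ∃ n, a = g 0 ∧ ((List.range n).map fun i => x (i + 1)).reduceOption =
      (List.range k).map fun i => g (i + 1) := by
    intro k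
    obtain ⟨n, hn⟩ := h (k + 1)
    cases n with
    | zero => simp at hn
    | succ n =>
      rw [map_range_succ, map_range_succ, h0, List.reduceOption_cons_of_some] at hn
      injection hn with h1 h2
      exact ⟨n, h1, h2⟩
  exact ⟨(key 0).choose_spec.1, fun k => ⟨_, (key k).choose_spec.2⟩⟩

end Concat

/-! ### Core languages in terms of letter steps -/

namespace StateMachine

variable {α : Type u} {A : StateMachine.{u, v} α}

/-- `w` is the trace of an infinite run from `q`. -/
def InfiniteTraceFrom (A : StateMachine.{u, v} α) (q : A.State) (w : Word α) : Prop :=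
  ∃ (s : ℕ → A.State) (x : ℕ → Option α),
    s 0 = q ∧ (∀ i, A.step (s i) (x i) (s (i + 1))) ∧ IsConcat x w

theorem Path.infiniteTraceFrom {q r : A.State} {m : List (Option α)} {l : List α}
    (h : A.Path q m r) (hr : A.InfiniteTraceFrom r (.fin l)) :
    A.InfiniteTraceFrom q (.fin (m.reduceOption ++ l)) := by
  induction h with
  | nil => exact hr
  | @cons q q' q'' x m hs _ ih =>
    obtain ⟨s, y, h0, hst, hc⟩ := ih hr
    refine ⟨fun i => Nat.casesOn i q s, fun i => Nat.casesOn i x y, rfl, ?_, ?_⟩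
    · rintro (_ | i)
      · simpa [h0] using hs
      · exact hst i
    · have := IsConcat.fin_cons (x := fun i => Nat.casesOn i x y) hc
      rwa [← List.append_assoc, ← List.reduceOption_append] at this

theorem exists_infinite_of_forall {σ : Type*} {β : Type*} {I : σ → Prop} {R : σ → β → σ → Prop}
    (h : ∀ q, I q → ∃ x q', I q' ∧ R q x q') {q : σ} (hq : I q) :
    ∃ (s : ℕ → σ) (x : ℕ → β), s 0 = q ∧ ∀ i, R (s i) (x i) (s (i + 1)) := by
  obtain ⟨x₀, -⟩ := h q hq
  have : Nonempty β := ⟨x₀⟩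
  choose! f g hI hR using h
  refine ⟨fun i => g^[i] q, fun i => f (g^[i] q), rfl, fun i => ?_⟩
  have : ∀ i, I (g^[i] q) := by
    intro i
    induction i with
    | zero => exact hq
    | succ i ih => rw [Function.iterate_succ_apply']; exact hI _ ih
  simpa only [Function.iterate_succ_apply'] using hR _ (this i)

/-- Dependent choice with prescribed labels: the invariant relates the current state to the rest of
the stream. -/
theorem exists_infinite_of_forall_stream {σ : Type*} {β : Type*} {I : σ → (ℕ → β) → Prop}
    {R : σ → β → σ → Prop}
    (h : ∀ q g, I q g → ∃ q', R q (g 0) q' ∧ I q' fun i => g (i + 1)) {q : σ} {g : ℕ → β}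
    (hq : I q g) : ∃ s : ℕ → σ, s 0 = q ∧ ∀ i, R (s i) (g i) (s (i + 1)) := by
  choose! f hR hI using h
  have key : ∀ i, I (Nat.rec q (fun i s => f s fun j => g (j + i)) i) fun j => g (j + i) := by
    intro i
    induction i with
    | zero => exact hq
    | succ i ih =>
      have := hI _ _ ih
      simpa only [Nat.add_right_comm, Nat.add_assoc] using this
  refine ⟨fun i => Nat.rec q (fun i s => f s fun j => g (j + i)) i, rfl, fun i => ?_⟩
  simpa using hR _ _ (key i)

/-- A finite trace comes from a run into a sink or from a run that ends in infinitely many ε. Both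
leave a terminal state behind, and from a terminal state one of the two is always possible. -/
theorem fin_mem_language_iff (hd : A.Dense) (hs : A.SinkFinal) {l : List α} :
    .fin l ∈ A.language ↔ ∃ r, A.WeakPath A.init l r ∧ A.Terminal r := by
  constructor
  · rintro (⟨q, hq, m, hm, hl⟩ | ⟨q, x, h0, hst, N, hN⟩)
    · obtain ⟨s, hw, he⟩ := hm.weakPath
      injection hl with hl
      subst hl
      exact ⟨s, hw, .of_eps hd he (terminal_of_isSink ((hs q).1 hq))⟩
    · have hp := path_of_run hst N
      obtain ⟨s, hw, he⟩ := hp.weakPath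
      rw [hN N le_rfl, h0] at hw
      refine ⟨s, hw, .of_eps hd he ?_⟩
      -- Once the trace is stable, no later label can contribute a letter.
      have hx : ∀ n, x (n + N) = none := by
        intro n
        have h1 := hN (n + N) (by omega)
        have h2 := hN (n + N + 1) (by omega)
        rw [List.range_succ, List.map_append, List.reduceOption_append, h1] at h2
        cases hx : x (n + N) with
        | none => rfl
        | some a => simp [hx] at h2
      have := terminal_of_diverges hd (q := fun n => q (n + N)) (fun i => by
        have := hst (i + N)
        rw [hx] at this
        simpa only [Nat.add_right_comm] using this)
      simpa using this
  · rintro ⟨r, hw, ht⟩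
    obtain ⟨m, hm, rfl⟩ := hw.path
    by_cases h : ∃ s, A.Eps r s ∧ A.IsSink s
    · obtain ⟨s, he, hsink⟩ := h
      obtain ⟨m', hm', e'⟩ := he.path
      exact .inl ⟨s, (hs s).2 hsink, m ++ m', hm.append hm', by
        simp [List.reduceOption_append, e']⟩
    -- If no sink is reachable by ε, each state reached has a transition, which must be ε since `r`
    -- is terminal; so the run can be prolonged forever.
    · right
      push Not at h
      have hstep : ∀ s, A.Eps r s → ∃ (_ : Unit) (s' : A.State), A.Eps r s' ∧ A.step s none s' := by
        intro s he
        have hn := h s he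
        simp only [IsSink, not_forall, not_not] at hn
        obtain ⟨x, s', hx⟩ := hn
        cases x with
        | none => exact ⟨(), s', he.tail hx, hx⟩
        | some x => exact absurd (he.bigStep ⟨0, .base hx⟩) (ht x s')
      obtain ⟨s, -, h0, hst⟩ := exists_infinite_of_forall
        (R := fun s (_ : Unit) s' => A.step s none s') hstep (.refl : A.Eps r r)
      have hr : A.InfiniteTraceFrom r (.fin []) :=
        ⟨s, fun _ => none, h0, hst, 0, fun n _ => by
          induction n with
          | zero => rfl
          | succ n ih => rw [map_range_succ, List.reduceOption_cons_of_none]; exact ih (by omega)⟩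
      have := hm.infiniteTraceFrom hr
      rwa [List.append_nil] at this

theorem InfiniteTraceFrom.bigStep {q : A.State} {g : ℕ → α}
    (h : A.InfiniteTraceFrom q (.inf g)) :
    ∃ q', A.BigStep q (g 0) q' ∧ A.InfiniteTraceFrom q' (.inf fun i => g (i + 1)) := by
  obtain ⟨s, x, rfl, hst, hc⟩ := h
  obtain ⟨n, hn⟩ := hc 1
  induction n generalizing s x with
  | zero => simp at hn
  | succ n ih =>
    cases hx : x 0 with
    | none =>
      rw [map_range_succ, hx, List.reduceOption_cons_of_none] at hn
      obtain ⟨q', hb, hq'⟩ := ih (fun i => s (i + 1)) (fun i => x (i + 1)) (fun i => hst (i + 1))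
        (hc.inf_none hx) hn
      exact ⟨q', hb.eps (hx ▸ hst 0), hq'⟩
    | some a =>
      obtain ⟨rfl, hc'⟩ := hc.inf_some hx
      exact ⟨s 1, ⟨0, .base (hx ▸ hst 0)⟩, fun i => s (i + 1), fun i => x (i + 1), rfl,
        fun i => hst (i + 1), hc'⟩

theorem infiniteTrace_of_bigSteps {g : ℕ → α} {s : ℕ → A.State}
    (h : ∀ i, A.BigStep (s i) (g i) (s (i + 1))) : A.InfiniteTraceFrom (s 0) (.inf g) := by
  choose k hk using h
  -- A configuration holds the current state, the index of the next letter and the number of ε still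
  -- to be taken before it.
  have next : ∀ p : A.State × ℕ × ℕ, A.WeakStep p.2.2 p.1 (g p.2.1) (s (p.2.1 + 1)) →
      ∃ (x : Option α) (p' : A.State × ℕ × ℕ),
        A.WeakStep p'.2.2 p'.1 (g p'.2.1) (s (p'.2.1 + 1)) ∧ A.step p.1 x p'.1 ∧
        (x = none ∧ p'.2.1 = p.2.1 ∧ p.2.2 = p'.2.2 + 1 ∨
          x = some (g p.2.1) ∧ p'.2.1 = p.2.1 + 1 ∧ p.2.2 = 0) := by
    rintro ⟨q, c, n⟩ hp
    cases hp with
    | base hs => exact ⟨some (g c), ⟨_, c + 1, k (c + 1)⟩, hk _, hs, .inr ⟨rfl, rfl, rfl⟩⟩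
    | eps hs hw => exact ⟨none, ⟨_, c, _⟩, hw, hs, .inl ⟨rfl, rfl, rfl⟩⟩
  obtain ⟨t, x, h0, ht⟩ := exists_infinite_of_forall next (q := ⟨s 0, 0, k 0⟩) (hk 0)
  refine ⟨fun i => (t i).1, x, by simp [h0], fun i => (ht i).1, ?_⟩
  have hpre : ∀ n, ((List.range n).map x).reduceOption = (List.range (t n).2.1).map g := by
    intro n
    induction n with
    | zero => simp [h0]
    | succ n ih =>
      rw [List.range_succ, List.map_append, List.reduceOption_append, ih]
      rcases (ht n).2 with ⟨hx, hc, -⟩ | ⟨hx, hc, -⟩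
      · simp [hx, hc]
      · simp [hx, hc, List.range_succ]
  -- The ε-counter decreases until a letter is read, so the letter index is unbounded.
  have hprog : ∀ j n, (t n).2.2 = j → ∃ n', (t n').2.1 = (t n).2.1 + 1 := by
    intro j
    induction j with
    | zero =>
      intro n hn
      rcases (ht n).2 with ⟨-, -, hc⟩ | ⟨-, hc, -⟩
      · omega
      · exact ⟨n + 1, hc⟩
    | succ j ih =>
      intro n hn
      rcases (ht n).2 with ⟨-, hc, hj⟩ | ⟨-, -, hj⟩
      · rw [← hc]
        exact ih (n + 1) (by omega)
      · omega
  intro m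
  suffices ∃ n, (t n).2.1 = m by
    obtain ⟨n, rfl⟩ := this
    exact ⟨n, hpre n⟩
  induction m with
  | zero => exact ⟨0, by simp [h0]⟩
  | succ m ih =>
    obtain ⟨n, rfl⟩ := ih
    exact hprog _ n rfl

theorem inf_mem_language_iff {g : ℕ → α} :
    .inf g ∈ A.language ↔
      ∃ s : ℕ → A.State, s 0 = A.init ∧ ∀ i, A.BigStep (s i) (g i) (s (i + 1)) := by
  constructor
  · rintro (⟨q, _, m, _, hl⟩ | h)
    · simp at hl
    · exact exists_infinite_of_forall_stream (I := fun q g => A.InfiniteTraceFrom q (.inf g))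
        (fun q g hq => hq.bigStep) h
  · rintro ⟨s, h0, hs⟩
    have := infiniteTrace_of_bigSteps hs
    rw [h0] at this
    exact .inr this

theorem WeakPath.exists_infinite {q r : A.State} {u : List α} (h : A.WeakPath q u r)
    {s : ℕ → A.State} {f : ℕ → α} (h0 : s 0 = r) (hs : ∀ i, A.BigStep (s i) (f i) (s (i + 1))) :
    ∃ (s' : ℕ → A.State) (f' : ℕ → α), s' 0 = q ∧
      (∀ i, A.BigStep (s' i) (f' i) (s' (i + 1))) ∧ (List.range u.length).map f' = u := by
  induction h with
  | nil => exact ⟨s, f, h0, hs, rfl⟩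
  | @cons q q' q'' x l hb _ ih =>
    obtain ⟨s', f', h0', hs', hl⟩ := ih h0
    refine ⟨fun i => Nat.casesOn i q s', fun i => Nat.casesOn i x f', rfl, ?_, ?_⟩
    · rintro (_ | i)
      · simpa [h0'] using hb
      · exact hs' i
    · rw [List.length_cons, map_range_succ]
      exact congrArg _ hl

/-- Either a terminal state can be reached, or letters can be read forever. This transfers
properties of prefixes of core words to all paths from the initial state. -/
theorem WeakPath.exists_mem_language (hd : A.Dense) (hs : A.SinkFinal) {u : List α}
    {q : A.State} (h : A.WeakPath A.init u q) : ∃ w ∈ A.language, Word.IsPrefix u w := by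
  by_cases hT : ∃ v r, A.WeakPath q v r ∧ A.Terminal r
  · obtain ⟨v, r, hv, hr⟩ := hT
    exact ⟨.fin (u ++ v), (fin_mem_language_iff hd hs).2 ⟨r, h.append hv, hr⟩, u.length, by
      simp [Word.take]⟩
  · push Not at hT
    have hstep : ∀ r, (∃ v, A.WeakPath q v r) →
        ∃ x r', (∃ v, A.WeakPath q v r') ∧ A.BigStep r x r' := by
      rintro r ⟨v, hv⟩
      have := hT v r hv
      simp only [Terminal, not_forall, not_not] at this
      obtain ⟨x, r', hb⟩ := this
      exact ⟨x, r', ⟨_, hv.append hb.weakPath⟩, hb⟩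
    obtain ⟨s, f, h0, hst⟩ := exists_infinite_of_forall hstep ⟨[], .nil q⟩
    obtain ⟨s', f', h0', hst', hl⟩ := h.exists_infinite h0 hst
    exact ⟨.inf f', inf_mem_language_iff.2 ⟨s', h0', hst'⟩, u.length, hl⟩

end StateMachine

end PSM

namespace PSM

universe u v

/-- Finite sequences of transitions of the relation `R`. -/
inductive RelPath {S β : Type*} (R : S → β → S → Prop) : S → List β → S → Prop
  | nil (q : S) : RelPath R q [] q
  | cons {q q' q'' : S} {x : β} {l : List β} :
      R q x q' → RelPath R q' l q'' → RelPath R q (x :: l) q''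

/-- The words that are spelled by the maximal paths of the relation `R`. -/
def relLanguage {S β : Type*} (R : S → β → S → Prop) (q : S) : Set (Word β)
  | .fin l => ∃ r, RelPath R q l r ∧ ∀ x r', ¬ R r x r'
  | .inf f => ∃ s : ℕ → S, s 0 = q ∧ ∀ i, R (s i) (f i) (s (i + 1))

/-! ### Alternation of sends and matching receives -/

section Alternation

variable {P : Type u} {V : Type v}

theorem eq_of_src_dst_msg {x y : Interaction P V} (h₁ : x.src = y.src) (h₂ : x.dst = y.dst)
    (h₃ : x.msg = y.msg) : x = y := by
  cases x; cases y; simp_all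

/-- The finite word over `Γ`, read as a word over `Σ`. -/
def expandList (l : List (Interaction P V)) : List (Event P V) :=
  l.flatMap fun x => [.snd x, .rcv x]

theorem expandList_append (l m : List (Interaction P V)) :
    expandList (l ++ m) = expandList l ++ expandList m := List.flatMap_append

namespace StateMachine

variable (M : StateMachine (Event P V))

def PairStep (q : M.State) (x : Interaction P V) (q' : M.State) : Prop :=
  ∃ s, M.BigStep q (.snd x) s ∧ M.BigStep s (.rcv x) q'

/-- `q` is reached directly after a sequence of interactions. -/
def Neutral (q : M.State) : Prop := ∃ l, M.WeakPath M.init (expandList l) q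

variable {M}

theorem neutral_init : M.Neutral M.init := ⟨[], .nil _⟩

theorem Neutral.pairStep {q q' : M.State} {x : Interaction P V} (h : M.Neutral q)
    (hx : M.PairStep q x q') : M.Neutral q' := by
  obtain ⟨l, hl⟩ := h
  obtain ⟨s, h₁, h₂⟩ := hx
  refine ⟨l ++ [x], ?_⟩
  rw [expandList_append]
  exact hl.append (.cons h₁ (.cons h₂ (.nil _)))

theorem weakPath_expandList {q r : M.State} {l : List (Interaction P V)}
    (h : RelPath M.PairStep q l r) (hq : M.Neutral q) :
    M.WeakPath q (expandList l) r ∧ M.Neutral r := by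
  induction h with
  | nil => exact ⟨.nil _, hq⟩
  | cons hx _ ih =>
    obtain ⟨hw, hr⟩ := ih (hq.pairStep hx)
    obtain ⟨s, h₁, h₂⟩ := hx
    exact ⟨.cons h₁ (.cons h₂ hw), hr⟩

end StateMachine

variable [DecidableEq P]

theorem sent_expandList (p q : P) (l : List (Interaction P V)) :
    sent p q (expandList l) = received p q (expandList l) := by
  induction l with
  | nil => rfl
  | cons x l ih =>
    have h : expandList (x :: l) = [.snd x, .rcv x] ++ expandList l := rfl
    rw [h, sent, received, List.filterMap_append, List.filterMap_append]
    change _ ++ sent p q _ = _ ++ received p q _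
    rw [ih]
    rfl

theorem sent_append (p q : P) (u w : List (Event P V)) :
    sent p q (u ++ w) = sent p q u ++ sent p q w := List.filterMap_append

theorem received_append (p q : P) (u w : List (Event P V)) :
    received p q (u ++ w) = received p q u ++ received p q w := List.filterMap_append

theorem sum_pending_snd_snd [Fintype P] (l : List (Interaction P V)) (x y : Interaction P V) :
    ∑ c : P × P with c.1 ≠ c.2, pending c.1 c.2 (expandList l ++ [.snd x, .snd y]) = 2 := by
  have h : ∀ c : P × P, pending c.1 c.2 (expandList l ++ [.snd x, .snd y]) =
      (if (x.src, x.dst) = c then 1 else 0) + if (y.src, y.dst) = c then 1 else 0 := by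
    rintro ⟨p, q⟩
    rw [pending, sent_append, received_append, sent_expandList]
    by_cases h₁ : x.src = p ∧ x.dst = q <;> by_cases h₂ : y.src = p ∧ y.dst = q <;>
      simp [sent, received, sentMsg, receivedMsg, h₁, h₂]
  simp only [h]
  rw [Finset.sum_add_distrib, Finset.sum_ite_eq, Finset.sum_ite_eq]
  simp [x.ne, y.ne]

namespace StateMachine

variable [Fintype P] {M : StateMachine (Event P V)}

theorem sumBounded_of_weakPath (hM : IsSumOnePSM M) (hs : M.SinkFinal) {u : List (Event P V)}
    {q : M.State} (h : M.WeakPath M.init u q) :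
    (∀ p q, received p q u <+: sent p q u) ∧
      ∑ c : P × P with c.1 ≠ c.2, pending c.1 c.2 u ≤ 1 := by
  obtain ⟨⟨B, hB⟩, h1⟩ := hM
  obtain ⟨w, hw, hu⟩ := h.exists_mem_language hB.dense hs
  exact ⟨(h1 w hw).1 u hu, by simpa using (h1 w hw).2 u hu⟩

/-- All channels are empty at a neutral state, so a receive would violate channel compliance. -/
theorem Neutral.eq_snd (hM : IsSumOnePSM M) (hs : M.SinkFinal) {q q' : M.State}
    (hq : M.Neutral q) {e : Event P V} (he : M.BigStep q e q') : ∃ x, e = .snd x := by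
  obtain ⟨l, hl⟩ := hq
  cases e with
  | snd x => exact ⟨x, rfl⟩
  | rcv x =>
    have := ((sumBounded_of_weakPath hM hs (hl.append he.weakPath)).1 x.src x.dst).length_le
    rw [sent_append, received_append, sent_expandList] at this
    simp [sent, received, sentMsg, receivedMsg, List.filterMap_cons] at this

/-- Otherwise a finite core word would end with a pending message. -/
theorem Neutral.not_terminal (hM : IsSumOnePSM M) (hs : M.SinkFinal) {q q' : M.State}
    (hq : M.Neutral q) {x : Interaction P V} (hx : M.BigStep q (.snd x) q') :
    ¬ M.Terminal q' := by
  intro ht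
  obtain ⟨l, hl⟩ := hq
  obtain ⟨⟨B, hB⟩, -⟩ := hM
  have hw := (fin_mem_language_iff hB.dense hs).2 ⟨q', hl.append hx.weakPath, ht⟩
  have := congrArg List.length ((hB.bounded hw).1.2 _ rfl x.src x.dst)
  rw [sent_append, received_append, sent_expandList] at this
  simp [sent, received, sentMsg, receivedMsg, List.filterMap_cons] at this

/-- A second send would make two messages pending, and the only message that can be received is the
one just sent. -/
theorem Neutral.eq_rcv (hM : IsSumOnePSM M) (hs : M.SinkFinal) {q q' q'' : M.State}
    (hq : M.Neutral q) {x : Interaction P V} (hx : M.BigStep q (.snd x) q') {e : Event P V}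
    (he : M.BigStep q' e q'') : e = .rcv x := by
  obtain ⟨l, hl⟩ := hq
  obtain ⟨hc, hsum⟩ := sumBounded_of_weakPath hM hs
    (hl.append (.cons hx (.cons he (.nil _))))
  cases e with
  | snd y => rw [sum_pending_snd_snd] at hsum; omega
  | rcv y =>
    have := hc y.src y.dst
    rw [sent_append, received_append, sent_expandList, List.prefix_append_right_inj] at this
    by_cases h : x.src = y.src ∧ x.dst = y.dst
    · simp [sent, received, sentMsg, receivedMsg, List.filterMap_cons, h] at this
      rw [eq_of_src_dst_msg h.1 h.2 this.symm]
    · simp [sent, received, sentMsg, receivedMsg, List.filterMap_cons, h] at this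

theorem Neutral.exists_pairStep (hM : IsSumOnePSM M) (hs : M.SinkFinal) {q q' : M.State}
    (hq : M.Neutral q) {x : Interaction P V} (hx : M.BigStep q (.snd x) q') :
    ∃ q'', M.BigStep q' (.rcv x) q'' := by
  have := hq.not_terminal hM hs hx
  simp only [Terminal, not_forall, not_not] at this
  obtain ⟨e, q'', he⟩ := this
  obtain rfl := hq.eq_rcv hM hs hx he
  exact ⟨q'', he⟩

theorem Neutral.terminal_iff (hM : IsSumOnePSM M) (hs : M.SinkFinal) {q : M.State}
    (hq : M.Neutral q) : M.Terminal q ↔ ∀ x q', ¬ M.PairStep q x q' := by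
  constructor
  · rintro h x q' ⟨s, hs, -⟩
    exact h _ _ hs
  · intro h e q' he
    obtain ⟨x, rfl⟩ := hq.eq_snd hM hs he
    obtain ⟨q'', hq''⟩ := hq.exists_pairStep hM hs he
    exact h x q'' ⟨q', he, hq''⟩

end StateMachine

namespace StateMachine

variable [Fintype P] {M : StateMachine (Event P V)}

theorem exists_expandList_of_weakPath (hM : IsSumOnePSM M) (hs : M.SinkFinal) :
    ∀ (u : List (Event P V)) (q r : M.State), M.Neutral q → M.WeakPath q u r → M.Terminal r →
      ∃ l, u = expandList l ∧ RelPath M.PairStep q l r ∧ M.Neutral r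
  | [], q, r, hq, h, hr => by
    cases h
    exact ⟨[], rfl, .nil _, hq⟩
  | [e], q, r, hq, h, hr => by
    obtain _ | ⟨he, h⟩ := h
    cases h
    obtain ⟨x, rfl⟩ := hq.eq_snd hM hs he
    exact absurd hr (hq.not_terminal hM hs he)
  | e :: e' :: u, q, r, hq, h, hr => by
    obtain _ | ⟨he, _ | ⟨he', h⟩⟩ := h
    obtain ⟨x, rfl⟩ := hq.eq_snd hM hs he
    obtain rfl := hq.eq_rcv hM hs he he'
    have hx : M.PairStep q x _ := ⟨_, he, he'⟩
    obtain ⟨l, rfl, hl, hn⟩ := exists_expandList_of_weakPath hM hs u _ r (hq.pairStep hx) h hr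
    exact ⟨x :: l, rfl, .cons hx hl, hn⟩

theorem expand_image_relLanguage (hM : IsSumOnePSM M) (hs : M.SinkFinal) :
    GlobalType.expand '' relLanguage M.PairStep M.init = M.language := by
  obtain ⟨B, hB⟩ := hM.1
  ext w
  constructor
  · rintro ⟨l | f, hw, rfl⟩
    · obtain ⟨r, hl, hr⟩ := hw
      obtain ⟨hw, hn⟩ := weakPath_expandList hl neutral_init
      exact (fin_mem_language_iff hB.dense hs).2 ⟨r, hw, (hn.terminal_iff hM hs).2 hr⟩
    · obtain ⟨s, h0, hst⟩ := hw
      choose t h₁ h₂ using hst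
      -- Even positions carry the neutral states, odd ones the states between a send and its
      -- receive.
      refine inf_mem_language_iff.2
        ⟨fun n => if n % 2 = 0 then s (n / 2) else t (n / 2), by simpa using h0, fun n => ?_⟩
      rcases Nat.mod_two_eq_zero_or_one n with h | h
      · have e₁ : (n + 1) % 2 = 1 := by omega
        have e₂ : (n + 1) / 2 = n / 2 := by omega
        simpa [h, e₁, e₂] using h₁ (n / 2)
      · have e₁ : (n + 1) % 2 = 0 := by omega
        have e₂ : (n + 1) / 2 = n / 2 + 1 := by omega
        simpa [h, e₁, e₂] using h₂ (n / 2)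
  · rcases w with u | f
    · intro hw
      obtain ⟨r, hu, hr⟩ := (fin_mem_language_iff hB.dense hs).1 hw
      obtain ⟨l, rfl, hl, hn⟩ := exists_expandList_of_weakPath hM hs u _ r neutral_init hu hr
      exact ⟨.fin l, ⟨r, hl, (hn.terminal_iff hM hs).1 hr⟩, rfl⟩
    · intro hw
      obtain ⟨s, h0, hst⟩ := inf_mem_language_iff.1 hw
      have step : ∀ i, M.Neutral (s (2 * i)) → ∃ x, f (2 * i) = .snd x ∧
          f (2 * i + 1) = .rcv x ∧ M.PairStep (s (2 * i)) x (s (2 * (i + 1))) := by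
        intro i hi
        have h₁ := hst (2 * i)
        have h₂ := hst (2 * i + 1)
        obtain ⟨x, hx⟩ := hi.eq_snd hM hs h₁
        rw [hx] at h₁
        have hy := hi.eq_rcv hM hs h₁ h₂
        rw [hy] at h₂
        exact ⟨x, hx, hy, _, h₁, h₂⟩
      have hn : ∀ i, M.Neutral (s (2 * i)) := by
        intro i
        induction i with
        | zero => simpa [h0] using neutral_init
        | succ i ih =>
          obtain ⟨x, -, -, hx⟩ := step i ih
          exact ih.pairStep hx
      choose x hx hy hp using fun i => step i (hn i)
      refine ⟨.inf x, ⟨fun i => s (2 * i), by simpa using h0, hp⟩, ?_⟩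
      refine congrArg Word.inf (funext fun n => ?_)
      rcases Nat.mod_two_eq_zero_or_one n with h | h
      · rw [if_pos h, ← hx]
        congr 1
        omega
      · rw [if_neg (by omega), ← hy]
        congr 1
        omega

end StateMachine

end Alternation

end PSM

namespace PSM

universe u v w

/-! ### Bisimilar relations spell the same words -/

section Bisimulation

variable {S T β : Type*} {R : S → β → S → Prop} {R' : T → β → T → Prop}

theorem StateMachine.weakPath_iff_relPath {α : Type u} {A : StateMachine.{u, v} α}
    {q r : A.State} {l : List α} : A.WeakPath q l r ↔ RelPath A.BigStep q l r := by
  constructor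
  · intro h
    induction h with
    | nil q => exact .nil q
    | cons hx _ ih => exact .cons hx ih
  · intro h
    induction h with
    | nil q => exact .nil q
    | cons hx _ ih => exact .cons hx ih

theorem StateMachine.language_eq_relLanguage {α : Type u} {A : StateMachine.{u, v} α}
    (hd : A.Dense) (hs : A.SinkFinal) : A.language = relLanguage A.BigStep A.init := by
  ext w
  rcases w with l | f
  · rw [fin_mem_language_iff hd hs]
    simp only [weakPath_iff_relPath]
    rfl
  · exact inf_mem_language_iff

theorem StateMachine.BigStep.cases_head {α : Type u} {A : StateMachine.{u, v} α} {q r : A.State}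
    {x : α} (h : A.BigStep q x r) :
    A.step q (some x) r ∨ ∃ q', A.step q none q' ∧ A.BigStep q' x r := by
  obtain ⟨k, hk⟩ := h
  cases hk with
  | base h => exact .inl h
  | eps h hk => exact .inr ⟨_, h, _, hk⟩

theorem RelPath.simulate {Z : S → T → Prop}
    (h : ∀ s t, Z s t → ∀ x s', R s x s' → ∃ t', R' t x t' ∧ Z s' t') {s s' : S} {l : List β}
    (hl : RelPath R s l s') {t : T} (hst : Z s t) : ∃ t', RelPath R' t l t' ∧ Z s' t' := by
  induction hl generalizing t with
  | nil => exact ⟨t, .nil t, hst⟩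
  | cons hx _ ih =>
    obtain ⟨t₁, h₁, z₁⟩ := h _ _ hst _ _ hx
    obtain ⟨t', h', z'⟩ := ih z₁
    exact ⟨t', .cons h₁ h', z'⟩

/-- Even the inclusion needs both directions: the backward one shows that a path that cannot be
continued is matched by another such path. -/
theorem relLanguage_subset_of_bisimulation {Z : S → T → Prop}
    (h : ∀ s t, Z s t → ∀ x s', R s x s' → ∃ t', R' t x t' ∧ Z s' t')
    (h' : ∀ s t, Z s t → ∀ x t', R' t x t' → ∃ s', R s x s' ∧ Z s' t') {s : S} {t : T}
    (hst : Z s t) : relLanguage R s ⊆ relLanguage R' t := by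
  rintro (l | f) hw
  · obtain ⟨r, hl, hr⟩ := hw
    obtain ⟨r', hl', z⟩ := hl.simulate h hst
    refine ⟨r', hl', fun x t' ht => ?_⟩
    obtain ⟨s', hs', -⟩ := h' _ _ z _ _ ht
    exact hr _ _ hs'
  · obtain ⟨p, h0, hp⟩ := hw
    refine StateMachine.exists_infinite_of_forall_stream
      (I := fun t g => ∃ p : ℕ → S, Z (p 0) t ∧ ∀ i, R (p i) (g i) (p (i + 1))) ?_
      ⟨p, h0 ▸ hst, hp⟩
    rintro t g ⟨p, hz, hp⟩
    obtain ⟨t', ht', z⟩ := h _ _ hz _ _ (hp 0)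
    exact ⟨t', ht', fun i => p (i + 1), z, fun i => hp (i + 1)⟩

theorem relLanguage_eq_of_bisimulation {Z : S → T → Prop}
    (h : ∀ s t, Z s t → ∀ x s', R s x s' → ∃ t', R' t x t' ∧ Z s' t')
    (h' : ∀ s t, Z s t → ∀ x t', R' t x t' → ∃ s', R s x s' ∧ Z s' t') {s : S} {t : T}
    (hst : Z s t) : relLanguage R s = relLanguage R' t :=
  (relLanguage_subset_of_bisimulation h h' hst).antisymm
    (relLanguage_subset_of_bisimulation (Z := fun t s => Z s t) (fun t s => h' s t)
      (fun t s => h s t) hst)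

end Bisimulation

namespace GlobalType

variable {P : Type u} {V : Type v}

/-! ### Subterms and the machine of a global type -/

section Sub

theorem sub_nil (G : GlobalType P V) : G.sub [] = some G := by cases G <;> rfl

theorem sub_append (G : GlobalType P V) (a b : List ℕ) :
    G.sub (a ++ b) = (G.sub a).bind fun H => H.sub b := by
  induction a generalizing G with
  | nil => simp [sub_nil]
  | cons i a ih =>
    cases G with
    | zero => rfl
    | var t => rfl
    | sum n lbl cont =>
      simp only [List.cons_append, sub]
      split
      · exact ih _
      · rfl
    | mu t body =>
      cases i with
      | zero => simpa only [List.cons_append, sub] using ih body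
      | succ i => rfl

variable {G : GlobalType P V}

theorem Step.not_of_zero {a b : List ℕ} {x : Option (Interaction P V)}
    (ha : G.sub a = some .zero) : ¬ Step G a x b := by
  intro h
  cases h <;> simp_all

theorem Step.of_sum {a b : List ℕ} {x : Option (Interaction P V)} {n : ℕ}
    {lbl : Fin (n + 1) → Interaction P V} {cont : Fin (n + 1) → GlobalType P V}
    (ha : G.sub a = some (.sum n lbl cont)) (h : Step G a x b) :
    ∃ i : Fin (n + 1), x = some (lbl i) ∧ b = a ++ [(i : ℕ)] := by
  cases h with
  | comm h i =>
    rw [ha] at h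
    cases h
    exact ⟨i, rfl, rfl⟩
  | unfold h => simp [ha] at h
  | recur h => simp [ha] at h

theorem Step.of_mu {a b : List ℕ} {x : Option (Interaction P V)} {t : ℕ} {g : GlobalType P V}
    (ha : G.sub a = some (.mu t g)) (h : Step G a x b) : x = none ∧ b = a ++ [0] := by
  cases h with
  | comm h i => simp [ha] at h
  | unfold h => exact ⟨rfl, rfl⟩
  | recur h => simp [ha] at h

theorem Step.of_var {a b : List ℕ} {x : Option (Interaction P V)} {t : ℕ}
    (ha : G.sub a = some (.var t)) (h : Step G a x b) :
    x = none ∧ ∃ g, G.sub b = some (.mu t g) := by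
  cases h with
  | comm h i => simp [ha] at h
  | unfold h => simp [ha] at h
  | recur h _ hb =>
    rw [ha] at h
    cases h
    exact ⟨rfl, _, hb⟩

/-- Only the jump from a variable could have several targets, and distinct binders bind distinct
variables. -/
theorem WellFormed.dense (hG : G.WellFormed) : G.machine.Dense := by
  rintro ⟨a, ha⟩ ⟨b, hb⟩ h x ⟨c, hc⟩ h'
  change Step G a none b at h
  change Step G a x c at h'
  obtain ⟨H, hH⟩ := Option.isSome_iff_exists.1 ha
  cases H with
  | zero => exact (Step.not_of_zero hH h).elim
  | sum n lbl cont =>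
    obtain ⟨i, hi, -⟩ := Step.of_sum hH h
    simp at hi
  | mu t g =>
    obtain ⟨rfl, rfl⟩ := Step.of_mu hH h'
    exact ⟨rfl, Subtype.ext (Step.of_mu hH h).2.symm⟩
  | var t =>
    obtain ⟨rfl, g', hg'⟩ := Step.of_var hH h'
    obtain ⟨-, g, hg⟩ := Step.of_var hH h
    exact ⟨rfl, Subtype.ext (hG.distinct _ _ _ _ _ hg' hg)⟩

/-- Sums are nonempty and variables are bound, so `0` alone has no transition. -/
theorem WellFormed.sinkFinal (hG : G.WellFormed) : G.machine.SinkFinal := by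
  rintro ⟨a, ha⟩
  constructor
  · rintro (h : G.sub a = some .zero) x ⟨b, hb⟩ hs
    change Step G a x b at hs
    cases hs <;> simp_all
  · intro h
    change G.sub a = some .zero
    obtain ⟨H, hH⟩ := Option.isSome_iff_exists.1 ha
    cases H with
    | zero => exact hH
    | sum n lbl cont =>
      refine absurd (Step.comm hH 0) (h _ ⟨a ++ [0], ?_⟩)
      rw [sub_append, hH]
      simp [sub, sub_nil]
    | mu t g =>
      refine absurd (Step.unfold hH) (h _ ⟨a ++ [0], ?_⟩)
      rw [sub_append, hH]
      simp [sub, sub_nil]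
    | var t =>
      obtain ⟨b, g, hb, hg, -⟩ := hG.bound_guarded a t hH
      exact absurd (Step.recur hH hb hg) (h _ ⟨b, by rw [hg]; rfl⟩)

end Sub

/-! ### Unfolding a finite transition system into a global type -/

section Build

variable {S : Type w} [DecidableEq S] (br : S → List (Interaction P V × S))

/-- The unfolding of the transition system with branches `br` from the state `q`, up to depth
`n`. The states on the current path are bound to variables by `env`, and the variable that is
introduced at the address `a` is the code of `a`. -/
def build : ℕ → (S → Option ℕ) → List ℕ → S → GlobalType P V
  | 0, _, _, _ => .zero
  | n + 1, env, a, q =>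
    match env q with
    | some t => .var t
    | none =>
      if h : br q = [] then .zero else
        .mu (Encodable.encode a) <| .sum ((br q).length - 1)
          (fun i => ((br q)[(i : ℕ)]'(by have := List.length_pos_iff.2 h; omega)).1)
          (fun i => build n (Function.update env q (some (Encodable.encode a))) (a ++ [0, (i : ℕ)])
            ((br q)[(i : ℕ)]'(by have := List.length_pos_iff.2 h; omega)).2)

/-- The choice between all branches of `q`. -/
def branchSum (n : ℕ) (env : S → Option ℕ) (a : List ℕ) (q : S) (h : br q ≠ []) :
    GlobalType P V :=
  .sum ((br q).length - 1)
    (fun i => ((br q)[(i : ℕ)]'(by have := List.length_pos_iff.2 h; omega)).1)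
    (fun i => build br n (Function.update env q (some (Encodable.encode a))) (a ++ [0, (i : ℕ)])
      ((br q)[(i : ℕ)]'(by have := List.length_pos_iff.2 h; omega)).2)

variable {br} {n : ℕ} {env : S → Option ℕ} {a : List ℕ} {q : S}

theorem build_var {t : ℕ} (h : env q = some t) : build br (n + 1) env a q = .var t := by
  simp [build, h]

theorem build_zero (h : env q = none) (h' : br q = []) : build br (n + 1) env a q = .zero := by
  simp [build, h, h']

theorem build_mu (h : env q = none) (h' : br q ≠ []) :
    build br (n + 1) env a q = .mu (Encodable.encode a) (branchSum br n env a q h') := by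
  simp [build, h, h', branchSum]

variable (br) in
/-- The arguments of the recursive calls of `build` with depth `N` and initial state `q₀`. -/
inductive Node (N : ℕ) (q₀ : S) : ℕ → (S → Option ℕ) → List ℕ → S → Prop
  | root : Node N q₀ N (fun _ => none) [] q₀
  | child {n : ℕ} {env : S → Option ℕ} {a : List ℕ} {q : S} :
      Node N q₀ (n + 1) env a q → env q = none → ∀ (i : ℕ) (hi : i < (br q).length),
      Node N q₀ n (Function.update env q (some (Encodable.encode a))) (a ++ [0, i]) (br q)[i].2

variable {N : ℕ} {q₀ : S}

theorem branchSum_sub {h : br q ≠ []} {i : ℕ} (hi : i < (br q).length) :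
    (branchSum br n env a q h).sub [i] =
      some (build br n (Function.update env q (some (Encodable.encode a))) (a ++ [0, i])
        (br q)[i].2) := by
  have : i < (br q).length - 1 + 1 := by omega
  simp [branchSum, sub, this, sub_nil]

theorem Node.sub_eq (h : Node br N q₀ n env a q) :
    (build br N (fun _ => none) [] q₀).sub a = some (build br n env a q) := by
  induction h with
  | root => exact sub_nil _
  | @child n env a q _ he i hi ih =>
    have hq : br q ≠ [] := List.length_pos_iff.1 (by omega)
    rw [sub_append, ih, build_mu he hq]
    exact branchSum_sub (h := hq) hi

theorem Node.sub_body (h : Node br N q₀ (n + 1) env a q) (he : env q = none) (hq : br q ≠ []) :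
    (build br N (fun _ => none) [] q₀).sub (a ++ [0]) = some (branchSum br n env a q hq) := by
  rw [sub_append, h.sub_eq, build_mu he hq]
  exact sub_nil _

/-- Entries of `env` are made only on the way down. The sum at `b ++ [0]` lies between binder and
use, which gives guardedness. -/
theorem Node.exists_binder (h : Node br N q₀ n env a q) {s : S} {t : ℕ} (hs : env s = some t) :
    ∃ n' env' b, Node br N q₀ (n' + 1) env' b s ∧ env' s = none ∧ br s ≠ [] ∧
      t = Encodable.encode b ∧ b ++ [0] <+: a := by
  induction h with
  | root => simp at hs
  | @child n env a q hn he i hi ih =>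
    by_cases hsq : s = q
    · subst hsq
      rw [Function.update_self] at hs
      injection hs with hs
      exact ⟨n, env, a, hn, he, List.length_pos_iff.1 (by omega), hs.symm, [i], by simp⟩
    · rw [Function.update_of_ne hsq] at hs
      obtain ⟨n', env', b, h₁, h₂, h₃, h₄, h₅⟩ := ih hs
      exact ⟨n', env', b, h₁, h₂, h₃, h₄, h₅.trans (List.prefix_append _ _)⟩

/-- The number of unbound states stays below the remaining depth, since each child binds one more
state. Hence the default `zero` at depth 0 is never used. -/
theorem Node.exists_succ [Fintype S] (hN : Fintype.card S < N) (h : Node br N q₀ n env a q) :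
    ∃ m, n = m + 1 := by
  suffices (Finset.univ.filter fun s => env s = none).card < n from ⟨n - 1, by omega⟩
  induction h with
  | root => simpa using hN
  | @child n env a q _ he i hi ih =>
    refine Nat.lt_of_lt_of_le (Finset.card_lt_card ?_) (Nat.lt_succ_iff.1 ih)
    refine (Finset.ssubset_iff_of_subset fun s hs => ?_).2 ⟨q, by simpa using he, by simp⟩
    by_cases hsq : s = q <;> simp_all

/-- Classifies all subterms: a recursive call of `build`, or the sum directly below its `μ`. -/
theorem exists_node_of_sub [Fintype S] (hN : Fintype.card S < N) {c : List ℕ}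
    {H : GlobalType P V} (h : (build br N (fun _ => none) [] q₀).sub c = some H) :
    (∃ n env q, Node br N q₀ (n + 1) env c q ∧ H = build br (n + 1) env c q) ∨
      ∃ n env a q, ∃ hq : br q ≠ [], Node br N q₀ (n + 1) env a q ∧ env q = none ∧
        c = a ++ [0] ∧ H = branchSum br n env a q hq := by
  induction c using List.reverseRecOn generalizing H with
  | nil =>
    have hr : Node br N q₀ N (fun _ => none) [] q₀ := .root
    obtain ⟨m, rfl⟩ := hr.exists_succ hN
    rw [sub_nil] at h
    injection h with h
    exact .inl ⟨m, _, q₀, hr, h.symm⟩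
  | append_singleton c i ih =>
    rw [sub_append, Option.bind_eq_some_iff] at h
    obtain ⟨H', hH', h⟩ := h
    rcases ih hH' with ⟨n, env, q, hn, rfl⟩ | ⟨n, env, a, q, hq, hn, he, rfl, rfl⟩
    · cases he : env q with
      | some t => rw [build_var he] at h; simp [sub] at h
      | none =>
        by_cases hq : br q = []
        · rw [build_zero he hq] at h; simp [sub] at h
        · rw [build_mu he hq] at h
          cases i with
          | succ i => simp [sub] at h
          | zero =>
            simp only [sub, sub_nil] at h
            injection h with h
            exact .inr ⟨n, env, c, q, hq, hn, he, rfl, h.symm⟩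
    · by_cases hi : i < (br q).length
      · rw [branchSum_sub hi] at h
        injection h with h
        have hc := hn.child he i hi
        obtain ⟨m, rfl⟩ := hc.exists_succ hN
        rw [List.append_assoc]
        exact .inl ⟨m, _, _, hc, h.symm⟩
      · have : ¬ i < (br q).length - 1 + 1 := by
          have := List.length_pos_iff.2 hq
          omega
        simp [branchSum, sub, this] at h

/-- The variable determines the address of its binder, so different binders bind different
variables. -/
theorem eq_encode_of_sub_mu [Fintype S] (hN : Fintype.card S < N) {c : List ℕ} {t : ℕ}
    {g : GlobalType P V} (h : (build br N (fun _ => none) [] q₀).sub c = some (.mu t g)) :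
    t = Encodable.encode c := by
  rcases exists_node_of_sub hN h with ⟨n, env, q, hn, hb⟩ | ⟨n, env, a, q, hq, -, -, -, hb⟩
  · cases he : env q with
    | some t => rw [build_var he] at hb; simp at hb
    | none =>
      by_cases hq : br q = []
      · rw [build_zero he hq] at hb; simp at hb
      · rw [build_mu he hq] at hb
        injection hb
  · simp [branchSum] at hb

theorem exists_node_of_sub_sum [Fintype S] (hN : Fintype.card S < N) {c : List ℕ} {k : ℕ}
    {lbl : Fin (k + 1) → Interaction P V} {cont : Fin (k + 1) → GlobalType P V}
    (h : (build br N (fun _ => none) [] q₀).sub c = some (.sum k lbl cont)) :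
    ∃ n env a q, ∃ hq : br q ≠ [], Node br N q₀ (n + 1) env a q ∧ env q = none ∧
        c = a ++ [0] ∧ .sum k lbl cont = branchSum br n env a q hq := by
  rcases exists_node_of_sub hN h with ⟨n, env, q, hn, hb⟩ | h
  · cases he : env q with
    | some t => rw [build_var he] at hb; simp at hb
    | none =>
      by_cases hq : br q = []
      · rw [build_zero he hq] at hb; simp at hb
      · rw [build_mu he hq] at hb; simp at hb
  · exact h

theorem exists_node_of_sub_var [Fintype S] (hN : Fintype.card S < N) {c : List ℕ} {t : ℕ}
    (h : (build br N (fun _ => none) [] q₀).sub c = some (.var t)) :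
    ∃ n env q, Node br N q₀ (n + 1) env c q ∧ env q = some t := by
  rcases exists_node_of_sub hN h with ⟨n, env, q, hn, hb⟩ | ⟨n, env, a, q, hq, -, -, -, hb⟩
  · cases he : env q with
    | some t =>
      rw [build_var he] at hb
      injection hb with hb
      exact ⟨n, env, q, hn, hb ▸ he⟩
    | none =>
      by_cases hq : br q = []
      · rw [build_zero he hq] at hb; simp at hb
      · rw [build_mu he hq] at hb; simp at hb
  · simp [branchSum] at hb

theorem build_wellFormed [Fintype S] (hN : Fintype.card S < N) :
    (build br N (fun _ => none) [] q₀).WellFormed where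
  distinct a b t g h ha hb := by
    have := (eq_encode_of_sub_mu hN ha).symm.trans (eq_encode_of_sub_mu hN hb)
    exact Encodable.encode_injective this
  bound_guarded a t ha := by
    obtain ⟨n, env, q, hn, he⟩ := exists_node_of_sub_var hN ha
    obtain ⟨n', env', b, hb, he', hq, rfl, hp⟩ := hn.exists_binder he
    refine ⟨b, _, (List.prefix_append _ _).trans hp, by rw [hb.sub_eq, build_mu he' hq],
      b ++ [0], _, _, _, List.prefix_append _ _, hp, hb.sub_body he' hq⟩

variable (br) in
/-- The transitions of the system with branches `br`. -/
def BranchStep (q : S) (x : Interaction P V) (q' : S) : Prop := (x, q') ∈ br q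

variable (br) in
/-- The address `a` of the unfolding represents the state `q`. -/
def Represents (N : ℕ) (q₀ : S) (a : List ℕ) (q : S) : Prop :=
  ∃ n env, Node br N q₀ (n + 1) env a q

/-- A representing address at which the state is bound by its `μ`. -/
theorem Represents.exists_binder (h : Represents br N q₀ a q) :
    ∃ n env b, Node br N q₀ (n + 1) env b q ∧ env q = none := by
  obtain ⟨n, env, hn⟩ := h
  cases he : env q with
  | none => exact ⟨n, env, a, hn, he⟩
  | some t =>
    obtain ⟨n', env', b, hb, he', -⟩ := hn.exists_binder he
    exact ⟨n', env', b, hb, he'⟩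

variable [Fintype S]

theorem Node.bigStep (hN : Fintype.card S < N)
    {a : (build br N (fun _ => none) [] q₀).machine.State}
    (hn : Node br N q₀ (n + 1) env a.1 q) (he : env q = none) {x : Interaction P V} {q' : S}
    (hx : BranchStep br q x q') :
    ∃ a' : (build br N (fun _ => none) [] q₀).machine.State,
      (build br N (fun _ => none) [] q₀).machine.BigStep a x a' ∧ Represents br N q₀ a'.1 q' := by
  obtain ⟨i, hi, hxi⟩ := List.getElem_of_mem hx
  have hq : br q ≠ [] := List.length_pos_iff.1 (by omega)
  have hc := hn.child he i hi
  obtain ⟨m, rfl⟩ := hc.exists_succ hN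
  have h₁ : ((build br N (fun _ => none) [] q₀).sub (a.1 ++ [0])).isSome := by
    rw [hn.sub_body he hq]; rfl
  have h₂ : ((build br N (fun _ => none) [] q₀).sub (a.1 ++ [0, i])).isSome := by
    rw [hc.sub_eq]; rfl
  -- The single ε unfolds the `μ`.
  refine ⟨⟨_, h₂⟩, ⟨1, .eps (q' := (⟨_, h₁⟩ : (build br N _ [] q₀).machine.State)) ?_ (.base ?_)⟩, ?_⟩
  · exact Step.unfold (hn.sub_eq.trans (congrArg some (build_mu he hq)))
  · have := Step.comm (hn.sub_body he hq) ⟨i, by omega⟩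
    simp only [hxi, List.append_assoc] at this
    exact this
  · rw [hxi] at hc
    exact ⟨m, _, hc⟩

/-- At a variable, one more ε leads back to the binder, which represents the same state. -/
theorem Represents.bigStep (hN : Fintype.card S < N)
    {a : (build br N (fun _ => none) [] q₀).machine.State} (h : Represents br N q₀ a.1 q)
    {x : Interaction P V} {q' : S} (hx : BranchStep br q x q') :
    ∃ a' : (build br N (fun _ => none) [] q₀).machine.State,
      (build br N (fun _ => none) [] q₀).machine.BigStep a x a' ∧ Represents br N q₀ a'.1 q' := by
  obtain ⟨n, env, hn⟩ := h
  cases he : env q with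
  | none => exact hn.bigStep hN he hx
  | some t =>
    obtain ⟨n', env', b, hb, he', hq, rfl, hp⟩ := hn.exists_binder he
    have hsub := hb.sub_eq.trans (congrArg some (build_mu he' hq))
    obtain ⟨a', hs, hr⟩ := Node.bigStep (a := ⟨b, by rw [hsub]; rfl⟩) hN hb he' hx
    refine ⟨a', hs.eps ?_, hr⟩
    exact Step.recur (hn.sub_eq.trans (congrArg some (build_var he)))
      ((List.prefix_append _ _).trans hp) hsub

theorem Node.branchStep (hN : Fintype.card S < N)
    {a a' : (build br N (fun _ => none) [] q₀).machine.State}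
    (hn : Node br N q₀ (n + 1) env a.1 q) (he : env q = none) {x : Interaction P V}
    (hx : (build br N (fun _ => none) [] q₀).machine.BigStep a x a') :
    ∃ q', BranchStep br q x q' ∧ Represents br N q₀ a'.1 q' := by
  have hsub := hn.sub_eq
  by_cases hq : br q = []
  · rw [build_zero he hq] at hsub
    rcases hx.cases_head with h | ⟨c, h, -⟩
    · exact (Step.not_of_zero hsub h).elim
    · exact (Step.not_of_zero hsub h).elim
  · rw [build_mu he hq] at hsub
    rcases hx.cases_head with h | ⟨c, h, hx⟩
    · simpa using (Step.of_mu hsub h).1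
    · have hbody := hn.sub_body he hq
      rw [← (Step.of_mu hsub h).2] at hbody
      rcases hx.cases_head with h' | ⟨d, h', -⟩
      · obtain ⟨i, hi, hb⟩ := Step.of_sum hbody h'
        have hi' : (i : ℕ) < (br q).length := by
          have := List.length_pos_iff.2 hq
          omega
        have hc := hn.child he i hi'
        obtain ⟨m, rfl⟩ := hc.exists_succ hN
        injection hi with hi
        refine ⟨(br q)[(i : ℕ)].2, ?_, m,
          Function.update env q (some (Encodable.encode a.1)), ?_⟩
        · rw [BranchStep, hi]
          exact List.getElem_mem hi'
        · rw [hb, (Step.of_mu hsub h).2, List.append_assoc]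
          exact hc
      · obtain ⟨i, hi, -⟩ := Step.of_sum hbody h'
        simp at hi

theorem Represents.branchStep (hN : Fintype.card S < N)
    {a a' : (build br N (fun _ => none) [] q₀).machine.State} (h : Represents br N q₀ a.1 q)
    {x : Interaction P V} (hx : (build br N (fun _ => none) [] q₀).machine.BigStep a x a') :
    ∃ q', BranchStep br q x q' ∧ Represents br N q₀ a'.1 q' := by
  obtain ⟨n, env, hn⟩ := h
  cases he : env q with
  | none => exact hn.branchStep hN he hx
  | some t =>
    obtain ⟨n', env', b, hb, he', hq, rfl, hp⟩ := hn.exists_binder he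
    have hsub := hn.sub_eq.trans (congrArg some (build_var he))
    have hsub' := hb.sub_eq.trans (congrArg some (build_mu he' hq))
    rcases hx.cases_head with h | ⟨c, h, hx⟩
    · simpa using (Step.of_var hsub h).1
    · obtain ⟨-, g, hg⟩ := Step.of_var hsub h
      -- The target of the jump is the binder recorded in `env`, since binders are unique.
      rw [← (build_wellFormed hN).distinct _ _ _ _ _ hg hsub'] at hb
      exact hb.branchStep hN he' hx

theorem language_build (hN : Fintype.card S < N) :
    (build br N (fun _ => none) [] q₀).machine.language = relLanguage (BranchStep br) q₀ := by
  have hG := build_wellFormed (br := br) (q₀ := q₀) hN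
  rw [StateMachine.language_eq_relLanguage hG.dense hG.sinkFinal]
  have hr : Node br N q₀ N (fun _ => none) [] q₀ := .root
  obtain ⟨m, hm⟩ := hr.exists_succ hN
  exact relLanguage_eq_of_bisimulation (Z := fun a q => Represents br N q₀ a.1 q)
    (fun a q h x a' hx => h.branchStep hN hx) (fun a q h x q' hx => h.bigStep hN hx)
    ⟨m, _, by rw [← hm]; exact hr⟩

/-- Every choice of the unfolding lists the branches of a state. -/
theorem exists_of_sub_sum (hN : Fintype.card S < N) {c : List ℕ} {k : ℕ}
    {lbl : Fin (k + 1) → Interaction P V} {cont : Fin (k + 1) → GlobalType P V}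
    (h : (build br N (fun _ => none) [] q₀).sub c = some (.sum k lbl cont)) :
    ∃ q, ∃ hk : k + 1 = (br q).length, ∀ i : Fin (k + 1), lbl i = ((br q)[(i : ℕ)]).1 := by
  obtain ⟨n, env, a, q, hq, -, -, -, hb⟩ := exists_node_of_sub_sum hN h
  have := List.length_pos_iff.2 hq
  rw [branchSum] at hb
  injection hb with h₁ h₂ h₃
  subst h₁
  exact ⟨q, by omega, fun i => by rw [eq_of_heq h₂]⟩

/-- The branches of a reachable state are listed by some choice of the unfolding. -/
theorem nonDeterministic_build (hN : Fintype.card S < N) {l : List (Interaction P V)}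
    (h : RelPath (BranchStep br) q₀ l q) {i j : ℕ} (hi : i < (br q).length)
    (hj : j < (br q).length) (hij : i ≠ j) (hl : (br q)[i].1 = (br q)[j].1) :
    (build br N (fun _ => none) [] q₀).NonDeterministic := by
  have hr : Node br N q₀ N (fun _ => none) [] q₀ := .root
  obtain ⟨m, hm⟩ := hr.exists_succ hN
  obtain ⟨a, -, ha⟩ := h.simulate
    (R' := (build br N (fun _ => none) [] q₀).machine.BigStep)
    (Z := fun q (a : (build br N (fun _ => none) [] q₀).machine.State) =>
      Represents br N q₀ a.1 q)
    (fun q a h x q' hx => h.bigStep hN hx)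
    (t := (build br N (fun _ => none) [] q₀).machine.init) ⟨m, _, by rw [← hm]; exact hr⟩
  have hq : br q ≠ [] := List.length_pos_iff.1 (by omega)
  obtain ⟨n, env, b, hb, he⟩ := ha.exists_binder
  intro hmix
  have := hmix _ _ _ _ (hb.sub_body he hq) ⟨i, by omega⟩ ⟨j, by omega⟩ (by simpa using hij)
  simp [hl] at this

end Build

end GlobalType

end PSM

namespace PSM

universe u v w

/-! ### Pair steps as branches, and the choice conditions -/

section Branches

variable {P : Type u} {V : Type v}

instance Interaction.finite [Finite P] [Finite V] : Finite (Interaction P V) :=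
  Finite.of_injective (fun x : Interaction P V => (x.src, x.dst, x.msg)) fun x y h => by
    simp only [Prod.mk.injEq] at h
    exact eq_of_src_dst_msg h.1 h.2.1 h.2.2

namespace StateMachine

theorem BigStep.unique {α : Type u} {A : StateMachine.{u, w} α} (hd : A.Dense)
    (hdet : A.Deterministic) {q r r' : A.State} {x : α} (h : A.BigStep q x r)
    (h' : A.BigStep q x r') : r = r' := by
  obtain ⟨k, hk⟩ := h
  induction hk with
  | base hs =>
    rcases h'.cases_head with hs' | ⟨_, hs', -⟩
    · exact hdet _ _ _ _ hs hs'
    · exact absurd (hd _ _ hs' _ _ hs).1 (by simp)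
  | eps hs _ ih => exact ih (h'.of_eps hd hs)

variable (M : StateMachine.{max u v, w} (Event P V))

/-- The ways to perform an interaction from `q`, with the intermediate state. -/
def pairSteps (q : M.State) : Set (Interaction P V × M.State × M.State) :=
  {t | M.BigStep q (.snd t.1) t.2.1 ∧ M.BigStep t.2.1 (.rcv t.1) t.2.2}

variable {M} in
-- By density both big steps follow the same ε-transitions, so both sends leave the same state,
-- whose value of `c` they share.
theorem BigStep.forall_eq_of_snd {β : Type*} (hd : M.Dense) {f : Interaction P V → β}
    {c : M.State → β} (hc : ∀ q x q', M.step q (some (.snd x)) q' → f x = c q) {q s t : M.State}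
    {x y : Interaction P V} (h : M.BigStep q (.snd x) s) (h' : M.BigStep q (.snd y) t) :
    f x = f y := by
  obtain ⟨k, hk⟩ := h
  generalize he : Event.snd x = e at hk
  induction hk with
  | base hs =>
    subst he
    rcases h'.cases_head with hs' | ⟨_, hs', -⟩
    · exact (hc _ _ _ hs).trans (hc _ _ _ hs').symm
    · exact absurd (hd _ _ hs' _ _ hs).1 (by simp)
  | eps hs _ ih => exact ih (h'.of_eps hd hs) he

variable [Finite P] [Finite V] [Finite M.State]

noncomputable def pairStepList (q : M.State) : List (Interaction P V × M.State × M.State) :=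
  (Set.toFinite (M.pairSteps q)).toFinset.toList

/-- Intermediate states are dropped only after listing, so two steps that differ just there yield a
repeated branch. -/
noncomputable def branches (q : M.State) : List (Interaction P V × M.State) :=
  (M.pairStepList q).map fun t => (t.1, t.2.2)

variable {M}

theorem mem_pairStepList {q : M.State} {t : Interaction P V × M.State × M.State} :
    t ∈ M.pairStepList q ↔ t ∈ M.pairSteps q := by
  simp [pairStepList]

theorem nodup_pairStepList {q : M.State} : (M.pairStepList q).Nodup := Finset.nodup_toList _

theorem branchStep_branches : GlobalType.BranchStep M.branches = M.PairStep := by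
  funext q x q'
  simp [GlobalType.BranchStep, branches, PairStep, mem_pairStepList, pairSteps]

/-- Determinism lets the label fix the intermediate and the final state, and the list of triples has
no duplicates. -/
theorem branches_injective (hd : M.Dense) (hdet : M.Deterministic) {q : M.State} {i j : ℕ}
    (hi : i < (M.branches q).length) (hj : j < (M.branches q).length)
    (h : (M.branches q)[i].1 = (M.branches q)[j].1) : i = j := by
  have hi' : i < (M.pairStepList q).length := by simpa [branches] using hi
  have hj' : j < (M.pairStepList q).length := by simpa [branches] using hj
  have h₁ := mem_pairStepList.1 (List.getElem_mem hi')
  have h₂ := mem_pairStepList.1 (List.getElem_mem hj')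
  simp only [branches, List.getElem_map] at h
  refine (nodup_pairStepList.getElem_inj_iff (hi := hi') (hj := hj')).1 ?_
  revert h h₁ h₂
  generalize (M.pairStepList q)[i] = s
  generalize (M.pairStepList q)[j] = t
  obtain ⟨x, s₁, s₂⟩ := s
  obtain ⟨y, t₁, t₂⟩ := t
  rintro ⟨h₁, h₁'⟩ ⟨h₂, h₂'⟩ h
  dsimp only at h h₁ h₁' h₂ h₂'
  subst h
  obtain rfl := h₁.unique hd hdet h₂
  obtain rfl := h₁'.unique hd hdet h₂'
  rfl

theorem exists_bigStep_of_mem_branches {q : M.State} {i : ℕ} (hi : i < (M.branches q).length) :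
    ∃ s, M.BigStep q (.snd (M.branches q)[i].1) s := by
  have hi' : i < (M.pairStepList q).length := by simpa [branches] using hi
  have := (mem_pairStepList.1 (List.getElem_mem hi')).1
  simp only [branches, List.getElem_map]
  exact ⟨_, this⟩

end StateMachine

end Branches

namespace StateMachine

variable {P : Type u} {V : Type v} [Fintype P] [DecidableEq P]
  {M : StateMachine.{max u v, w} (Event P V)}

/-- Every reachable state is reached by interactions, possibly followed by a send event. -/
theorem exists_relPath_of_weakPath (hM : IsSumOnePSM M) (hs : M.SinkFinal) :
    ∀ (u : List (Event P V)) (q r : M.State), M.Neutral q → M.WeakPath q u r →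
      ∃ l s, RelPath M.PairStep q l s ∧ M.Neutral s ∧ (s = r ∨ ∃ x, M.BigStep s (.snd x) r)
  | [], q, r, hq, h => by
    cases h
    exact ⟨[], q, .nil _, hq, .inl rfl⟩
  | [e], q, r, hq, h => by
    obtain _ | ⟨he, h⟩ := h
    cases h
    obtain ⟨x, rfl⟩ := hq.eq_snd hM hs he
    exact ⟨[], q, .nil _, hq, .inr ⟨x, he⟩⟩
  | e :: e' :: u, q, r, hq, h => by
    obtain _ | ⟨he, _ | ⟨he', h⟩⟩ := h
    obtain ⟨x, rfl⟩ := hq.eq_snd hM hs he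
    obtain rfl := hq.eq_rcv hM hs he he'
    have hx : M.PairStep q x _ := ⟨_, he, he'⟩
    obtain ⟨l, s, hl, hn, h⟩ := exists_relPath_of_weakPath hM hs u _ r (hq.pairStep hx) h
    exact ⟨x :: l, s, .cons hx hl, hn, h⟩

/-- Two equal sends are both completed by receives and differ in the intermediate state; two equal
receives share the preceding send and differ in the final state. -/
theorem exists_pairSteps_of_reachablyNonDeterministic (hM : IsSumOnePSM M) (hs : M.SinkFinal)
    (h : M.ReachablyNonDeterministic) :
    ∃ l q, RelPath M.PairStep M.init l q ∧
      ∃ t ∈ M.pairSteps q, ∃ t' ∈ M.pairSteps q, t ≠ t' ∧ t.1 = t'.1 := by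
  obtain ⟨B, hB⟩ := hM.1
  obtain ⟨q, ⟨m, hm⟩, x, r, r', hr, hr', hne⟩ := h
  obtain ⟨s, hw, he⟩ := hm.weakPath
  cases x with
  | none => exact absurd (hB.dense _ _ hr' _ _ hr).2 hne
  | some e =>
    have hb : M.BigStep s e r := he.bigStep ⟨0, .base hr⟩
    have hb' : M.BigStep s e r' := he.bigStep ⟨0, .base hr'⟩
    obtain ⟨l, n, hl, hn, rfl | ⟨x, hx⟩⟩ :=
      exists_relPath_of_weakPath hM hs _ _ _ neutral_init hw
    · obtain ⟨x, rfl⟩ := hn.eq_snd hM hs hb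
      obtain ⟨t, ht⟩ := hn.exists_pairStep hM hs hb
      obtain ⟨t', ht'⟩ := hn.exists_pairStep hM hs hb'
      exact ⟨l, n, hl, (x, r, t), ⟨hb, ht⟩, (x, r', t'), ⟨hb', ht'⟩, by simp [hne], rfl⟩
    · obtain rfl := hn.eq_rcv hM hs hx hb
      exact ⟨l, n, hl, (x, s, r), ⟨hx, hb⟩, (x, s, r'), ⟨hx, hb'⟩, by simp [hne], rfl⟩

theorem nonDeterministic_build_branches [Fintype M.State] [DecidableEq M.State] [Finite V]
    (hM : IsSumOnePSM M) (hs : M.SinkFinal) (h : M.ReachablyNonDeterministic) {N : ℕ}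
    (hN : Fintype.card M.State < N) :
    (GlobalType.build M.branches N (fun _ => none) [] M.init).NonDeterministic := by
  obtain ⟨l, q, hl, t, ht, t', ht', hne, heq⟩ :=
    exists_pairSteps_of_reachablyNonDeterministic hM hs h
  obtain ⟨i, hi, rfl⟩ := List.getElem_of_mem (mem_pairStepList.2 ht)
  obtain ⟨j, hj, rfl⟩ := List.getElem_of_mem (mem_pairStepList.2 ht')
  rw [← branchStep_branches] at hl
  refine GlobalType.nonDeterministic_build hN hl (i := i) (j := j) (by simpa [branches] using hi)
    (by simpa [branches] using hj) ?_ (by simpa [branches] using heq)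
  rintro rfl
  exact hne rfl

end StateMachine

end PSM

/-! ### The global type of a sink-final 1-PSM -/

theorem mainTheorem7 {P : Type*} {V : Type*} [Fintype P] [DecidableEq P] [Finite V]
    (M : PSM.StateMachine (PSM.Event P V)) (hM : PSM.IsSumOnePSM M) (hsink : M.SinkFinal) :
    ∃ G : PSM.GlobalType P V, G.WellFormed ∧
      G.coreLanguage = M.language ∧
      G.semantics = PSM.semantics M ∧
      (M.ReachablyNonDeterministic → G.NonDeterministic) ∧
      (PSM.MixedChoice M → G.MixedChoice) ∧
      (PSM.SenderDriven M → G.SenderDriven) ∧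
      (PSM.Directed M → G.Directed) := by
  classical
  obtain ⟨B, hB⟩ := hM.1
  have := hB.finite
  have := Fintype.ofFinite M.State
  have hN := Nat.lt_succ_self (Fintype.card M.State)
  have hlang : (PSM.GlobalType.build M.branches (Fintype.card M.State).succ (fun _ => none) []
      M.init).coreLanguage = M.language := by
    rw [PSM.GlobalType.coreLanguage, PSM.GlobalType.language_build hN,
      PSM.StateMachine.branchStep_branches]
    exact PSM.StateMachine.expand_image_relLanguage hM hsink
  -- All three choice conditions reduce to this: a sum belongs to one state, which can read all its
  -- sends.
  have key : ∀ {a n lbl cont}, (PSM.GlobalType.build M.branches (Fintype.card M.State).succ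
      (fun _ => none) [] M.init).sub a = some (.sum n lbl cont) →
      ∃ q, (M.Deterministic → Function.Injective lbl) ∧
        ∀ i, ∃ s, M.BigStep q (.snd (lbl i)) s := by
    intro a n lbl cont h
    obtain ⟨q, hk, hl⟩ := PSM.GlobalType.exists_of_sub_sum hN h
    refine ⟨q, fun hdet i j hij => ?_, fun i => ?_⟩
    · rw [hl, hl] at hij
      exact Fin.ext (PSM.StateMachine.branches_injective hB.dense hdet _ _ hij)
    · rw [hl]
      exact PSM.StateMachine.exists_bigStep_of_mem_branches _
  refine ⟨_, PSM.GlobalType.build_wellFormed hN, hlang, congrArg PSM.closure hlang,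
    fun h => PSM.StateMachine.nonDeterministic_build_branches hM hsink h hN, ?_, ?_, ?_⟩
  · intro hdet a n lbl cont h i j hij
    obtain ⟨q, hinj, -⟩ := key h
    by_contra! hc
    exact hij (hinj hdet (PSM.eq_of_src_dst_msg hc.1 hc.2.1 hc.2.2))
  · rintro ⟨hdet, c, hc⟩ a n lbl cont h i j hij
    obtain ⟨q, hinj, hs⟩ := key h
    obtain ⟨s, hi⟩ := hs i
    obtain ⟨t, hj⟩ := hs j
    have hsrc := hi.forall_eq_of_snd hB.dense hc hj
    refine ⟨hsrc, ?_⟩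
    by_contra! hne
    exact hij (hinj hdet (PSM.eq_of_src_dst_msg hsrc hne.1 hne.2))
  · rintro ⟨hdet, c, d, hcd⟩ a n lbl cont h i j hij
    obtain ⟨q, hinj, hs⟩ := key h
    obtain ⟨s, hi⟩ := hs i
    obtain ⟨t, hj⟩ := hs j
    have hsrc := hi.forall_eq_of_snd hB.dense (fun q x q' hx => (hcd q x q' hx).1) hj
    have hdst := hi.forall_eq_of_snd hB.dense (fun q x q' hx => (hcd q x q' hx).2) hj
    exact ⟨hsrc, hdst, fun hmsg => hij (hinj hdet (PSM.eq_of_src_dst_msg hsrc hdst hmsg))⟩
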